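/- Theorem. Let $e(\theta)=e^{2\pi i\theta}$. For real $p\ge 1$ and integers $N\ge 1$ put \[M_p(N)=\int_0^1 \max_{0\le t\le 1}\Bigl|\sum_{n=1}^N e(nx+n^2t)\Bigr|^p\,dx .\] Let $a(p)=\frac{3p}{4}$ for $1\le p\le 4$ and $a(p)=p-1$ for $p>4$; let $b(4)=1$ and $b(p)=0$ for $p\ge 1$, $p\ne 4$. Then for every real $p\ge 1$ there are constants $c,C>0$, depending only on $p$, such that for all integers $N\ge 2$ \[c\,N^{a(p)}(\log N)^{b(p)}\le M_p(N)\le C\,N^{a(p)}(\log N)^{b(p)} .\] -/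

import Mathlib

/-- The quadratic Weyl sum `∑_{n=1}^N e(n x + n² t)`, where `e(θ) = exp(2πiθ)`. -/
noncomputable def weylSum (N : ℕ) (x t : ℝ) : ℂ :=
  ∑ n ∈ Finset.Icc 1 N,
    Complex.exp (2 * Real.pi * Complex.I * ((n : ℂ) * (x : ℂ) + (n : ℂ) ^ 2 * (t : ℂ)))

/-- The maximal function `max_{0 ≤ t ≤ 1} |∑_{n=1}^N e(n x + n² t)|^p`. -/
noncomputable def weylMax (p : ℝ) (N : ℕ) (x : ℝ) : ℝ :=
  sSup ((fun t : ℝ => ‖weylSum N x t‖ ^ p) '' Set.Icc (0 : ℝ) 1)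

/-- `M_p(N) = ∫_0^1 max_{0 ≤ t ≤ 1} |∑_{n=1}^N e(n x + n² t)|^p dx`. -/
noncomputable def weylMoment (p : ℝ) (N : ℕ) : ℝ :=
  ∫ x in (0 : ℝ)..1, weylMax p N x

/-- The exponent `a(p)` of `N`. -/
noncomputable def weylExpA (p : ℝ) : ℝ := if p ≤ 4 then 3 * p / 4 else p - 1

/-- The exponent `b(p)` of `log N`. -/
noncomputable def weylExpB (p : ℝ) : ℝ := if p = 4 then 1 else 0

theorem continuous_weylSum_rpow {p : ℝ} (hp : 0 ≤ p) (N : ℕ) :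
    Continuous fun z : ℝ × ℝ => ‖weylSum N z.1 z.2‖ ^ p := by
  refine Continuous.rpow_const ?_ fun _ => Or.inr hp
  unfold weylSum
  fun_prop

/-- The supremum in `weylMax` is attained, so that it is a maximum. -/
theorem isGreatest_weylMax {p : ℝ} (hp : 0 ≤ p) (N : ℕ) (x : ℝ) :
    IsGreatest ((fun t : ℝ => ‖weylSum N x t‖ ^ p) '' Set.Icc (0 : ℝ) 1) (weylMax p N x) := by
  have h₀ := continuous_weylSum_rpow hp N
  unfold weylMax
  generalize weylSum N = S at h₀ ⊢
  have h : Continuous fun t : ℝ => ‖S x t‖ ^ p :=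
    h₀.comp (continuous_const.prodMk continuous_id : Continuous fun t : ℝ => (x, t))
  exact (isCompact_Icc.image h).isGreatest_sSup ((Set.nonempty_Icc.2 zero_le_one).image _)

/-- The maximal function is continuous, so that the integral in `weylMoment` is a genuine one. -/
theorem continuous_weylMax {p : ℝ} (hp : 0 ≤ p) (N : ℕ) : Continuous (weylMax p N) := by
  have h := continuous_weylSum_rpow hp N
  unfold weylMax
  generalize weylSum N = S at h ⊢
  exact IsCompact.continuous_sSup (f := fun x t : ℝ => ‖S x t‖ ^ p) isCompact_Icc h

theorem intervalIntegrable_weylMax {p : ℝ} (hp : 0 ≤ p) (N : ℕ) :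
    IntervalIntegrable (weylMax p N) MeasureTheory.volume 0 1 :=
  (continuous_weylMax hp N).intervalIntegrable 0 1

/-! Write S(x,t) for the Weyl sum. Let t = a/q + β with |β| ≤ 1/(8qN), and let b/q be a nearest
fraction to x with denominator q, not necessarily reduced; put γ = x - b/q. Expanding e((an² +
bn)/q) in characters mod q turns qS(x,t) into a sum over k of Gauss sums times S(k/q + γ, β). The
term k = 0 is the main term. For the others the phase increments stay away from the integers, so the
Kusmin–Landau inequality makes their total contribution to S(x,t) at most 120 q^{3/4}
(`norm_weylSum_sub_le`).

Upper bound. The main term is at most of order q^{-1/2} N (1 + N|γ|)^{-1/2}, uniformly in β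
(`norm_weylSum_le_rpow`). Dirichlet's theorem supplies q ≤ 8N, so either |S| is O(N^{3/4}) or x lies
in a peak around some b/q with q ≤ √N (`norm_weylSum_le_major`). Since t has disappeared, this
bounds the maximal function. Integrating p-th powers for p > 2 gives N^{3p/4} + N^{p-1} ∑ q^{1-p/2}
over q ≤ √N, and this sum changes behaviour at p = 4. Smaller p follow by comparison with an
exponent between 2 and 4.

Lower bound. For odd q ≤ √N, the choice t = 1/q makes |S| at least N/(4√q) on an interval of length
1/(6N) at each reduced b/q. These intervals are disjoint, so the moment is at least a totient sum
(`sum_totient_mul_le_weylMoment`). Averages of the totient over odd q give N^{3p/4}, and the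
logarithm at p = 4; for p > 4 the interval at 0 alone suffices. -/

/-! ### The Kusmin–Landau inequality -/

/-- The additive character `θ ↦ e(θ) = exp(2πiθ)`. -/
noncomputable def ex (θ : ℝ) : ℂ := Complex.exp (2 * Real.pi * Complex.I * (θ : ℂ))

theorem ex_add (x y : ℝ) : ex (x + y) = ex x * ex y := by
  unfold ex
  rw [← Complex.exp_add]
  push_cast
  ring_nf

theorem norm_ex (x : ℝ) : ‖ex x‖ = 1 := by
  unfold ex
  have h : 2 * (Real.pi : ℂ) * Complex.I * (x : ℂ) = ((2 * Real.pi * x : ℝ) : ℂ) * Complex.I := by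
    push_cast; ring
  rw [h, Complex.norm_exp_ofReal_mul_I]

theorem ex_int (k : ℤ) : ex k = 1 := by
  unfold ex
  rw [Complex.exp_eq_one_iff]
  exact ⟨k, by push_cast; ring⟩

theorem ex_eq (x : ℝ) :
    ex x = (Real.cos (2 * (Real.pi * x)) : ℝ) + (Real.sin (2 * (Real.pi * x)) : ℝ) * Complex.I := by
  unfold ex
  have h : 2 * (Real.pi : ℂ) * Complex.I * (x : ℂ) =
      ((2 * (Real.pi * x) : ℝ) : ℂ) * Complex.I := by
    push_cast; ring
  rw [h, Complex.exp_mul_I, Complex.ofReal_cos, Complex.ofReal_sin]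

theorem conj_ex (x : ℝ) : (starRingEnd ℂ) (ex x) = ex (-x) := by
  rw [ex_eq, ex_eq]
  simp [Complex.conj_ofReal, -Complex.ofReal_cos, -Complex.ofReal_sin]

/-- Half the cotangent of `πθ`. -/
noncomputable def halfCot (θ : ℝ) : ℝ := Real.cos (Real.pi * θ) / (2 * Real.sin (Real.pi * θ))

theorem sin_pi_mul_pos {θ : ℝ} (h0 : 0 < θ) (h1 : θ < 1) : 0 < Real.sin (Real.pi * θ) :=
  Real.sin_pos_of_pos_of_lt_pi (by positivity) (by nlinarith [Real.pi_pos])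

theorem two_mul_le_sin_pi_mul {θ δ : ℝ} (hδ : 0 ≤ δ) (h0 : δ ≤ θ) (h1 : θ ≤ 1 - δ) :
    2 * δ ≤ Real.sin (Real.pi * θ) := by
  have hp := Real.pi_pos
  have key : ∀ u : ℝ, 0 ≤ u → u ≤ 1 / 2 → 2 * u ≤ Real.sin (Real.pi * u) := by
    intro u hu0 hu1
    have := Real.mul_le_sin (x := Real.pi * u) (by positivity) (by nlinarith)
    have h2 : 2 / Real.pi * (Real.pi * u) = 2 * u := by field_simp
    linarith
  rcases le_total θ (1 / 2) with h | h
  · have := key θ (by linarith) h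
    linarith
  · have := key (1 - θ) (by linarith) (by linarith)
    rw [show Real.pi * (1 - θ) = Real.pi - Real.pi * θ by ring, Real.sin_pi_sub] at this
    linarith

theorem halfCot_antitone {a b : ℝ} (ha : 0 < a) (hab : a ≤ b) (hb : b < 1) :
    halfCot b ≤ halfCot a := by
  have hsa := sin_pi_mul_pos ha (hab.trans_lt hb)
  have hsb := sin_pi_mul_pos (ha.trans_le hab) hb
  unfold halfCot
  rw [div_le_div_iff₀ (by positivity) (by positivity)]
  have h : 0 ≤ Real.sin (Real.pi * b - Real.pi * a) :=
    Real.sin_nonneg_of_nonneg_of_le_pi (by nlinarith [Real.pi_pos]) (by nlinarith [Real.pi_pos])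
  rw [Real.sin_sub] at h
  linarith

/-- The coefficient `1 / (1 - e(θ))`. -/
noncomputable def kusminCoeff (θ : ℝ) : ℂ := 1 / 2 + (halfCot θ : ℂ) * Complex.I

theorem kusminCoeff_mul {θ : ℝ} (h0 : 0 < θ) (h1 : θ < 1) :
    kusminCoeff θ * (1 - ex θ) = 1 := by
  have hs := (sin_pi_mul_pos h0 h1).ne'
  have hsq := Real.sin_sq_add_cos_sq (Real.pi * θ)
  unfold kusminCoeff
  rw [ex_eq, Real.cos_two_mul, Real.sin_two_mul]
  unfold halfCot
  set s := Real.sin (Real.pi * θ)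
  set c := Real.cos (Real.pi * θ)
  apply Complex.ext
  · simp [-Complex.ofReal_cos, -Complex.ofReal_sin, -Complex.ofReal_div, -Complex.ofReal_mul]
    norm_cast
    field_simp
    nlinarith
  · simp [-Complex.ofReal_cos, -Complex.ofReal_sin, -Complex.ofReal_div, -Complex.ofReal_mul]
    norm_cast
    field_simp
    linear_combination (-2 * c) * hsq

theorem norm_kusminCoeff_le {θ δ : ℝ} (hδ : 0 < δ) (h0 : δ ≤ θ) (h1 : θ ≤ 1 - δ) :
    ‖kusminCoeff θ‖ ≤ 1 / (4 * δ) := by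
  have hm := congrArg norm (kusminCoeff_mul (θ := θ) (by linarith) (by linarith))
  rw [norm_mul, norm_one] at hm
  have hn : 4 * δ ≤ ‖1 - ex θ‖ := by
    have h := Complex.norm_exp_I_mul_ofReal_sub_one (2 * (Real.pi * θ))
    have he : Complex.exp (Complex.I * ((2 * (Real.pi * θ) : ℝ) : ℂ)) = ex θ := by
      unfold ex; push_cast; ring_nf
    rw [he, show 2 * (Real.pi * θ) / 2 = Real.pi * θ by ring] at h
    rw [norm_sub_rev, h, Real.norm_eq_abs]
    have := two_mul_le_sin_pi_mul hδ.le h0 h1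
    exact le_trans (by linarith) (le_abs_self _)
  rw [le_div_iff₀ (by positivity)]
  calc _ ≤ ‖kusminCoeff θ‖ * ‖1 - ex θ‖ := by gcongr
    _ = 1 := hm

theorem abs_halfCot_le {θ δ : ℝ} (hδ : 0 < δ) (h0 : δ ≤ θ) (h1 : θ ≤ 1 - δ) :
    |halfCot θ| ≤ 1 / (4 * δ) := by
  have h := Complex.abs_im_le_norm (kusminCoeff θ)
  have h2 : (kusminCoeff θ).im = halfCot θ := by simp [kusminCoeff]
  rw [h2] at h
  exact h.trans (norm_kusminCoeff_le hδ h0 h1)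

/-- The Kusmin–Landau inequality for increments that increase. -/
theorem kusmin_landau_of_monotone (φ : ℕ → ℝ) (m : ℕ) {δ : ℝ} (hδ : 0 < δ)
    (hlo : ∀ n < m, δ ≤ φ (n + 1) - φ n) (hhi : ∀ n < m, φ (n + 1) - φ n ≤ 1 - δ)
    (hmono : ∀ n, n + 1 < m → φ (n + 1) - φ n ≤ φ (n + 2) - φ (n + 1)) :
    ‖∑ n ∈ Finset.range m, ex (φ n)‖ ≤ 1 / δ := by
  set θ : ℕ → ℝ := fun n => φ (n + 1) - φ n with hθ
  -- Each term is a difference: e(φ n) = c(θ n) (e(φ n) - e(φ (n+1))) with c = 1/(1 - e). This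
  -- prepares summation by parts.
  have hstep : ∀ n < m, ex (φ n) + kusminCoeff (θ n) * ex (φ (n + 1)) =
      kusminCoeff (θ n) * ex (φ n) := by
    intro n hn
    have h := kusminCoeff_mul (θ := θ n) (hδ.trans_le (hlo n hn))
      (by have := hhi n hn; simp only [hθ]; linarith)
    have h2 : ex (φ (n + 1)) = ex (θ n) * ex (φ n) := by
      rw [← ex_add]; simp [hθ]
    rw [h2]
    linear_combination (-ex (φ n)) * h
  -- The coefficients have constant real part 1/2 and monotone imaginary part, so their total
  -- variation telescopes.
  have key : ∀ k, k < m → ‖∑ n ∈ Finset.range (k + 1), ex (φ n) +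
      kusminCoeff (θ k) * ex (φ (k + 1))‖ ≤ 1 / (4 * δ) + (halfCot (θ 0) - halfCot (θ k)) := by
    intro k
    induction k with
    | zero =>
      intro hk
      simp only [zero_add, Finset.sum_range_one, sub_self, add_zero]
      rw [hstep 0 hk, norm_mul, norm_ex, mul_one]
      exact norm_kusminCoeff_le hδ (hlo 0 hk) (hhi 0 hk)
    | succ k ih =>
      intro hk
      have hk' : k < m := by omega
      have e1 : ∑ n ∈ Finset.range (k + 1 + 1), ex (φ n) +
          kusminCoeff (θ (k + 1)) * ex (φ (k + 1 + 1)) =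
          (∑ n ∈ Finset.range (k + 1), ex (φ n) + kusminCoeff (θ k) * ex (φ (k + 1))) +
          (kusminCoeff (θ (k + 1)) - kusminCoeff (θ k)) * ex (φ (k + 1)) := by
        rw [Finset.sum_range_succ]
        linear_combination hstep (k + 1) hk
      have e2 : ‖(kusminCoeff (θ (k + 1)) - kusminCoeff (θ k)) * ex (φ (k + 1))‖ =
          halfCot (θ k) - halfCot (θ (k + 1)) := by
        have : kusminCoeff (θ (k + 1)) - kusminCoeff (θ k) =
            ((halfCot (θ (k + 1)) - halfCot (θ k) : ℝ) : ℂ) * Complex.I := by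
          unfold kusminCoeff; push_cast; ring
        rw [norm_mul, norm_ex, mul_one, this, norm_mul, Complex.norm_I, mul_one,
          Complex.norm_real, Real.norm_eq_abs, abs_sub_comm, abs_of_nonneg]
        have := halfCot_antitone (hδ.trans_le (hlo k hk')) (hmono k hk)
          (by have := hhi (k + 1) hk; simp only [add_assoc] at this; norm_num at this; linarith)
        simp only [hθ, sub_nonneg]
        exact this
      rw [e1]
      refine (norm_add_le _ _).trans ?_
      rw [e2]
      linarith [ih hk']
  rcases Nat.eq_zero_or_pos m with rfl | hm
  · simp [hδ.le]
  obtain ⟨k, rfl⟩ : ∃ k, m = k + 1 := ⟨m - 1, by omega⟩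
  have h := key k (by omega)
  have h0 := abs_le.1 (abs_halfCot_le hδ (hlo 0 (by omega)) (hhi 0 (by omega)))
  have hk := abs_le.1 (abs_halfCot_le hδ (hlo k (by omega)) (hhi k (by omega)))
  have hc := norm_kusminCoeff_le hδ (hlo k (by omega)) (hhi k (by omega))
  have h3 : ‖kusminCoeff (θ k) * ex (φ (k + 1))‖ ≤ 1 / (4 * δ) := by
    rw [norm_mul, norm_ex, mul_one]; exact hc
  have h4 := norm_sub_le (∑ n ∈ Finset.range (k + 1), ex (φ n) +
      kusminCoeff (θ k) * ex (φ (k + 1))) (kusminCoeff (θ k) * ex (φ (k + 1)))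
  rw [add_sub_cancel_right] at h4
  -- Four quantities of size at most 1/(4δ): the first coefficient, the boundary term, and the two
  -- ends of the telescoped cotangent.
  have h5 : 1 / δ = 4 * (1 / (4 * δ)) := by field_simp
  rw [h5]
  simp only [hθ] at *
  linarith [h0.2, hk.1]

/-- The Kusmin–Landau inequality for quadratic phases. -/
theorem kusmin_landau_quadratic (α β : ℝ) (k : ℤ) (A B : ℕ) {δ : ℝ} (hδ : 0 < δ)
    (hlo : ∀ n, A ≤ n → n < B → k + δ ≤ α + β * (2 * n + 1))
    (hhi : ∀ n, A ≤ n → n < B → α + β * (2 * n + 1) ≤ k + 1 - δ) :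
    ‖∑ n ∈ Finset.Ico A B, ex (α * n + β * n ^ 2)‖ ≤ 1 / δ := by
  rw [Finset.sum_Ico_eq_sum_range]
  rcases le_total 0 β with hβ | hβ
  · have h := kusmin_landau_of_monotone
      (fun n => (α - k) * ((A + n : ℕ) : ℝ) + β * ((A + n : ℕ) : ℝ) ^ 2) (B - A) hδ
      (fun n hn => by
        have := hlo (A + n) (by omega) (by omega); push_cast at this ⊢; nlinarith)
      (fun n hn => by
        have := hhi (A + n) (by omega) (by omega); push_cast at this ⊢; nlinarith)
      (fun n hn => by push_cast; nlinarith)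
    refine le_of_eq_of_le ?_ h
    congr 1
    refine Finset.sum_congr rfl fun n _ => ?_
    rw [show α * ((A + n : ℕ) : ℝ) + β * ((A + n : ℕ) : ℝ) ^ 2 =
      ((α - k) * ((A + n : ℕ) : ℝ) + β * ((A + n : ℕ) : ℝ) ^ 2) + ((k * (A + n : ℕ) : ℤ) : ℝ) by
        push_cast; ring, ex_add, ex_int, mul_one]
  -- For β ≤ 0 the increments decrease; conjugating and adding the integer frequency k + 1 reverses
  -- them and keeps them in [δ, 1 - δ].
  · have h := kusmin_landau_of_monotone
      (fun n => (k + 1 - α) * ((A + n : ℕ) : ℝ) - β * ((A + n : ℕ) : ℝ) ^ 2) (B - A) hδ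
      (fun n hn => by
        have := hhi (A + n) (by omega) (by omega); push_cast at this ⊢; nlinarith)
      (fun n hn => by
        have := hlo (A + n) (by omega) (by omega); push_cast at this ⊢; nlinarith)
      (fun n hn => by push_cast; nlinarith)
    refine le_of_eq_of_le ?_ h
    rw [← Complex.norm_conj, map_sum]
    congr 1
    refine Finset.sum_congr rfl fun n _ => ?_
    rw [conj_ex, show (k + 1 - α) * ((A + n : ℕ) : ℝ) - β * ((A + n : ℕ) : ℝ) ^ 2 =
      -(α * ((A + n : ℕ) : ℝ) + β * ((A + n : ℕ) : ℝ) ^ 2) +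
        (((k + 1) * (A + n : ℕ) : ℤ) : ℝ) by push_cast; ring, ex_add, ex_int, mul_one]

/-! ### Complete quadratic Gauss sums -/

theorem card_two_mul_eq_zero_le (q : ℕ) [NeZero q] :
    (Finset.univ.filter fun h : ZMod q => 2 * h = 0).card ≤ 2 := by
  have := IsAddCyclic.card_nsmul_eq_zero_le (α := ZMod q) (n := 2) (by norm_num)
  simpa [nsmul_eq_mul] using this

/-- The complete quadratic Gauss sum. -/
noncomputable def quadGauss (q : ℕ) [NeZero q] (a c : ZMod q) : ℂ :=
  ∑ r : ZMod q, ZMod.stdAddChar (a * r ^ 2 + c * r)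

/-- Weyl differencing: after r = s + h the sum over s is linear, and orthogonality keeps only 2ah =
0, that is 2h = 0. The linear coefficient c plays no role in this condition, so b/q need not be
reduced later. -/
theorem quadGauss_mul_conj (q : ℕ) [NeZero q] {a : ZMod q} (ha : IsUnit a) (c : ZMod q) :
    quadGauss q a c * (starRingEnd ℂ) (quadGauss q a c) =
      q * ∑ h ∈ Finset.univ.filter fun h : ZMod q => 2 * h = 0,
        ZMod.stdAddChar (a * h ^ 2 + c * h) := by
  have hp := ZMod.isPrimitive_stdAddChar q
  unfold quadGauss
  rw [map_sum, Finset.sum_mul_sum, Finset.sum_comm]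
  have h1 : ∀ s : ZMod q, ∑ r : ZMod q, (ZMod.stdAddChar (a * r ^ 2 + c * r) : ℂ) *
      (starRingEnd ℂ) (ZMod.stdAddChar (a * s ^ 2 + c * s)) =
      ∑ h : ZMod q, (ZMod.stdAddChar (a * h ^ 2 + c * h) : ℂ) *
        ZMod.stdAddChar (s * (2 * a * h)) := by
    intro s
    rw [← Equiv.sum_comp (Equiv.addRight s)]
    refine Finset.sum_congr rfl fun h _ => ?_
    rw [← AddChar.map_neg_eq_conj, ← AddChar.map_add_eq_mul, ← AddChar.map_add_eq_mul]
    congr 1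
    simp only [Equiv.coe_addRight]
    ring
  rw [Finset.sum_congr rfl fun s _ => h1 s, Finset.sum_comm, Finset.sum_filter, Finset.mul_sum]
  refine Finset.sum_congr rfl fun h _ => ?_
  rw [← Finset.mul_sum, AddChar.sum_mulShift _ hp, ZMod.card]
  have h2 : 2 * a * h = 0 ↔ 2 * h = 0 := by
    rw [show 2 * a * h = a * (2 * h) by ring, ha.mul_right_eq_zero]
  simp only [h2]
  split_ifs <;> simp [mul_comm]

theorem norm_quadGauss_sq_le (q : ℕ) [NeZero q] {a : ZMod q} (ha : IsUnit a) (c : ZMod q) :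
    ‖quadGauss q a c‖ ^ 2 ≤ 2 * q := by
  have h := congrArg norm (quadGauss_mul_conj q ha c)
  rw [norm_mul, Complex.norm_conj, norm_mul, Complex.norm_natCast, ← sq] at h
  rw [h, mul_comm]
  gcongr
  refine (norm_sum_le _ _).trans ?_
  simp only [AddChar.norm_apply, Finset.sum_const, nsmul_eq_mul, mul_one]
  exact_mod_cast card_two_mul_eq_zero_le q

theorem norm_quadGauss_sq_of_odd (q : ℕ) [NeZero q] (hq : Odd q) {a : ZMod q} (ha : IsUnit a)
    (c : ZMod q) : ‖quadGauss q a c‖ ^ 2 = q := by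
  have h := congrArg norm (quadGauss_mul_conj q ha c)
  rw [norm_mul, Complex.norm_conj, norm_mul, Complex.norm_natCast, ← sq] at h
  have h2 : IsUnit (2 : ZMod q) := by
    have := (ZMod.isUnit_iff_coprime 2 q).2 (Nat.coprime_two_left.2 hq)
    simpa using this
  have h3 : (Finset.univ.filter fun h : ZMod q => 2 * h = 0) = {0} := by
    ext h; simp [h2.mul_right_eq_zero]
  rw [h, h3]
  simp

/-! ### Approximation near rational points -/

theorem ex_intCast_div (q : ℕ) [NeZero q] (j : ℤ) :
    ex ((j : ℝ) / q) = ZMod.stdAddChar (j : ZMod q) := by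
  rw [ZMod.stdAddChar_coe]
  unfold ex
  push_cast
  ring_nf

theorem weylSum_eq (N : ℕ) (x t : ℝ) :
    weylSum N x t = ∑ n ∈ Finset.Icc 1 N, ex (x * n + t * n ^ 2) := by
  unfold weylSum ex
  refine Finset.sum_congr rfl fun n _ => ?_
  push_cast
  ring_nf

/-- Fourier expansion of a quadratic character modulo `q`. -/
theorem stdAddChar_quadratic_expansion (q : ℕ) [NeZero q] (a b n : ZMod q) :
    (q : ℂ) * ZMod.stdAddChar (a * n ^ 2 + b * n) =
      ∑ k : ZMod q, quadGauss q a (b - k) * ZMod.stdAddChar (k * n) := by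
  have hp := ZMod.isPrimitive_stdAddChar q
  unfold quadGauss
  simp_rw [Finset.sum_mul]
  rw [Finset.sum_comm]
  have h1 : ∀ r : ZMod q, ∑ k : ZMod q, (ZMod.stdAddChar (a * r ^ 2 + (b - k) * r) : ℂ) *
      ZMod.stdAddChar (k * n) = ZMod.stdAddChar (a * r ^ 2 + b * r) *
        (if n - r = 0 then (q : ℂ) else 0) := by
    intro r
    have h := AddChar.sum_mulShift (n - r) hp
    rw [ZMod.card] at h
    push_cast at h
    rw [← h, Finset.mul_sum]
    refine Finset.sum_congr rfl fun k _ => ?_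
    rw [← AddChar.map_add_eq_mul, ← AddChar.map_add_eq_mul]
    congr 1
    ring
  rw [Finset.sum_congr rfl fun r _ => h1 r]
  simp only [mul_ite, mul_zero, sub_eq_zero]
  rw [Finset.sum_ite_eq]
  simp [mul_comm]

theorem weylSum_expansion (q : ℕ) [NeZero q] (a b : ℤ) (N : ℕ) (γ β : ℝ) :
    (q : ℂ) * weylSum N (b / q + γ) (a / q + β) =
      ∑ k : ZMod q, quadGauss q a (b - k) * weylSum N (k.val / q + γ) β := by
  simp_rw [weylSum_eq, Finset.mul_sum]
  rw [Finset.sum_comm]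
  refine Finset.sum_congr rfl fun n _ => ?_
  have h := stdAddChar_quadratic_expansion q a b n
  have h1 : ex ((b / q + γ) * n + (a / q + β) * n ^ 2) =
      ZMod.stdAddChar ((a : ZMod q) * (n : ZMod q) ^ 2 + (b : ZMod q) * (n : ZMod q)) *
        ex (γ * n + β * n ^ 2) := by
    rw [show (b / q + γ) * n + (a / q + β) * n ^ 2 =
      ((a * n ^ 2 + b * n : ℤ) : ℝ) / q + (γ * n + β * n ^ 2) by push_cast; ring, ex_add,
      ex_intCast_div]
    push_cast
    rfl
  rw [h1, ← mul_assoc, h, Finset.sum_mul]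
  refine Finset.sum_congr rfl fun k _ => ?_
  have h2 : ex ((k.val / q + γ) * n + β * n ^ 2) =
      ZMod.stdAddChar (k * (n : ZMod q)) * ex (γ * n + β * n ^ 2) := by
    rw [show (k.val / q + γ) * n + β * n ^ 2 =
      ((k.val * n : ℤ) : ℝ) / q + (γ * n + β * n ^ 2) by push_cast; ring, ex_add,
      ex_intCast_div]
    push_cast
    rw [ZMod.natCast_zmod_val]
  rw [h2]
  ring

/-- Sum over a nonzero frequency, by the Kusmin–Landau inequality. -/
theorem norm_weylSum_shift_le {q N k : ℕ} (hk : 1 ≤ k) (hkq : k < q) (hN : 1 ≤ N) {γ β : ℝ}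
    (hγ : |γ| ≤ 1 / (2 * q)) (hβ : |β| ≤ 1 / (8 * q * N)) :
    ‖weylSum N (k / q + γ) β‖ ≤ 8 * q / k + 8 * q / ((q - k : ℕ) : ℝ) := by
  have hq : (0 : ℝ) < q := by exact_mod_cast (by omega : 0 < q)
  have hN' : (1 : ℝ) ≤ N := by exact_mod_cast hN
  have hk' : (1 : ℝ) ≤ k := by exact_mod_cast hk
  have hkq' : (1 : ℝ) ≤ ((q - k : ℕ) : ℝ) := by exact_mod_cast (by omega : 1 ≤ q - k)
  have hcast : ((q - k : ℕ) : ℝ) = q - k := by rw [Nat.cast_sub hkq.le]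
  rw [hcast] at hkq'
  rw [hcast]
  have hkq0 : 0 < (q : ℝ) - k := by linarith
  have hmin : 0 < min (k : ℝ) (q - k) := lt_min (by linarith) hkq0
  -- In units of 1/(8q) the shift γ moves the increment by at most 4 and β(2n+1) by at most 3, since
  -- 2n + 1 ≤ 3N. So it stays 8k - 7 ≥ k units above 0, and likewise q - k units below 1.
  set δ : ℝ := min (k : ℝ) (q - k) / (8 * q) with hδ
  have hδpos : 0 < δ := by positivity
  have hδ1 : δ ≤ k / (8 * q) := by rw [hδ]; gcongr; exact min_le_left _ _
  have hδ2 : δ ≤ (q - k) / (8 * q) := by rw [hδ]; gcongr; exact min_le_right _ _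
  have hb : ∀ n : ℕ, n < N + 1 → |β * (2 * n + 1)| ≤ 3 / (8 * q) := by
    intro n hn
    rw [abs_mul, abs_of_nonneg (by positivity : (0 : ℝ) ≤ 2 * n + 1)]
    have : (n : ℝ) ≤ N := by exact_mod_cast (by omega : n ≤ N)
    calc |β| * (2 * n + 1) ≤ 1 / (8 * q * N) * (3 * N) := by gcongr; linarith
      _ = 3 / (8 * q) := by field_simp
  have hg := abs_le.1 hγ
  have e1 : (1 : ℝ) / (2 * q) = 4 * (1 / (8 * q)) := by field_simp; norm_num
  have e2 : (3 : ℝ) / (8 * q) = 3 * (1 / (8 * q)) := by field_simp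
  have e3 : (k : ℝ) / (8 * q) = k * (1 / (8 * q)) := by field_simp
  have e4 : ((q : ℝ) - k) / (8 * q) = (q - k) * (1 / (8 * q)) := by field_simp
  have e5 : (k : ℝ) / q = 8 * k * (1 / (8 * q)) := by field_simp
  have e6 : (1 : ℝ) = 8 * q * (1 / (8 * q)) := by field_simp
  have hu : 0 < 1 / (8 * (q : ℝ)) := by positivity
  rw [e1] at hg
  rw [e3] at hδ1
  rw [e4] at hδ2
  have h := kusmin_landau_quadratic (k / q + γ) β 0 1 (N + 1) hδpos
    (fun n _ hn => by
      have := (abs_le.1 (hb n hn)).1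
      rw [e2] at this
      rw [e5]
      push_cast
      nlinarith [mul_le_mul_of_nonneg_right hk' hu.le, mul_le_mul_of_nonneg_right hkq' hu.le])
    (fun n _ hn => by
      have := (abs_le.1 (hb n hn)).2
      rw [e2] at this
      rw [e5]
      push_cast
      nlinarith [mul_le_mul_of_nonneg_right hk' hu.le, mul_le_mul_of_nonneg_right hkq' hu.le])
  rw [weylSum_eq, ← Finset.Ico_add_one_right_eq_Icc]
  refine h.trans ?_
  have hA : 0 ≤ 8 * (q : ℝ) / k := by positivity
  have hB : 0 ≤ 8 * (q : ℝ) / (q - k) := div_nonneg (by positivity) hkq0.le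
  rw [hδ, one_div_div]
  rcases min_choice (k : ℝ) (q - k) with h | h <;> rw [h] <;> linarith

theorem sum_zmod_eq_sum_range (q : ℕ) [NeZero q] (f : ZMod q → ℂ) :
    ∑ k, f k = ∑ k ∈ Finset.range q, f (k : ℕ) := by
  cases q with
  | zero => exact absurd rfl (NeZero.ne 0)
  | succ m =>
    rw [Finset.sum_range]
    refine Finset.sum_congr rfl fun k _ => ?_
    congr 1
    exact (ZMod.natCast_zmod_val (n := m + 1) k).symm

/-- The nonzero frequencies contribute q^{-1} · √q · ∑ q/k, which is √q log q up to a constant. The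
weaker exponent 3/4 swallows the logarithm and still gives N^{3/4} for q of order N. -/
theorem norm_weylSum_sub_le {q : ℕ} [NeZero q] {a : ℤ} (ha : IsUnit (a : ZMod q)) (b : ℤ) {N : ℕ}
    (hN : 1 ≤ N) {γ β : ℝ} (hγ : |γ| ≤ 1 / (2 * q)) (hβ : |β| ≤ 1 / (8 * q * N)) :
    ‖weylSum N (b / q + γ) (a / q + β) - quadGauss q a b / q * weylSum N γ β‖ ≤
      120 * (q : ℝ) ^ (3 / 4 : ℝ) := by
  have hq0 : q ≠ 0 := NeZero.ne q
  have hq1 : (1 : ℝ) ≤ q := by exact_mod_cast Nat.one_le_iff_ne_zero.2 hq0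
  have hqC : (q : ℂ) ≠ 0 := by exact_mod_cast hq0
  have hexp := weylSum_expansion q a b N γ β
  obtain ⟨m, hq⟩ : ∃ m, q = m + 1 := ⟨q - 1, by omega⟩
  have hrange : ∀ f : ℕ → ℂ, ∑ k ∈ Finset.range q, f k =
      ∑ k ∈ Finset.range m, f (k + 1) + f 0 := by
    intro f; rw [hq, Finset.sum_range_succ']
  have hG : ∀ c : ZMod q, ‖quadGauss q a c‖ ≤ 3 / 2 * √q := by
    intro c
    have h := norm_quadGauss_sq_le q ha c
    refine abs_le_of_sq_le_sq' ?_ (by positivity) |>.2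
    rw [mul_pow, Real.sq_sqrt (by positivity)]
    linarith
  have hsum : ∑ k : ZMod q, quadGauss q a (b - k) * weylSum N (k.val / q + γ) β =
      quadGauss q a b * weylSum N γ β + ∑ k ∈ Finset.range m,
        quadGauss q a (b - ((k + 1 : ℕ) : ZMod q)) * weylSum N ((k + 1 : ℕ) / q + γ) β := by
    rw [sum_zmod_eq_sum_range, hrange, add_comm]
    congr 1
    · simp
    · refine Finset.sum_congr rfl fun k hk => ?_
      rw [ZMod.val_natCast_of_lt (by have := Finset.mem_range.1 hk; omega)]
  have hmain : weylSum N (b / q + γ) (a / q + β) - quadGauss q a b / q * weylSum N γ β =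
      (∑ k ∈ Finset.range m,
        quadGauss q a (b - ((k + 1 : ℕ) : ZMod q)) * weylSum N ((k + 1 : ℕ) / q + γ) β) / q := by
    rw [eq_div_iff hqC]
    rw [hsum] at hexp
    rw [sub_mul, div_mul_eq_mul_div, div_mul_cancel₀ _ hqC]
    linear_combination hexp
  -- Uses 1 + log q ≤ 1 + 4 q^{1/4}.
  have hH : ∑ k ∈ Finset.range m, (1 / ((k + 1 : ℕ) : ℝ)) ≤ 5 * (q : ℝ) ^ (1 / 4 : ℝ) := by
    have h1 : ∑ k ∈ Finset.range m, (1 / ((k + 1 : ℕ) : ℝ)) ≤ (harmonic q : ℝ) := by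
      rw [harmonic, hq, Finset.sum_range_succ]
      push_cast
      simp only [one_div]
      have : (0 : ℝ) ≤ ((m : ℝ) + 1)⁻¹ := by positivity
      linarith
    have h2 := harmonic_le_one_add_log q
    have h3 := Real.log_le_rpow_div (x := (q : ℝ)) (by positivity) (ε := 1 / 4) (by norm_num)
    have h4 := Real.one_le_rpow hq1 (z := 1 / 4) (by norm_num)
    linarith
  have hrefl : ∑ k ∈ Finset.range m, (1 / ((q - (k + 1) : ℕ) : ℝ)) =
      ∑ k ∈ Finset.range m, (1 / ((k + 1 : ℕ) : ℝ)) := by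
    rw [← Finset.sum_range_reflect]
    refine Finset.sum_congr rfl fun k hk => ?_
    have := Finset.mem_range.1 hk
    congr 3
    omega
  rw [hmain, norm_div, Complex.norm_natCast, div_le_iff₀ (by positivity)]
  calc _ ≤ ∑ k ∈ Finset.range m, 3 / 2 * √q *
        (8 * q * (1 / ((k + 1 : ℕ) : ℝ)) + 8 * q * (1 / ((q - (k + 1) : ℕ) : ℝ))) := by
        refine (norm_sum_le _ _).trans (Finset.sum_le_sum fun k hk => ?_)
        rw [norm_mul]
        have := Finset.mem_range.1 hk
        have h := norm_weylSum_shift_le (q := q) (N := N) (k := k + 1) (by omega) (by omega) hN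
          hγ hβ
        gcongr
        · exact hG _
        · refine h.trans_eq ?_
          ring
    _ = 24 * (√q * q) * ∑ k ∈ Finset.range m, (1 / ((k + 1 : ℕ) : ℝ)) := by
        rw [← Finset.mul_sum, Finset.sum_add_distrib, ← Finset.mul_sum, ← Finset.mul_sum, hrefl]
        ring
    _ ≤ 24 * (√q * q) * (5 * (q : ℝ) ^ (1 / 4 : ℝ)) := by gcongr
    _ = 120 * ((q : ℝ) ^ (1 / 2 : ℝ) * (q : ℝ) ^ (1 / 4 : ℝ)) * q := by
        rw [Real.sqrt_eq_rpow]; ring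
    _ = _ := by
        rw [← Real.rpow_add (by positivity), show (1 / 2 + 1 / 4 : ℝ) = 3 / 4 by norm_num]

/-! ### The sum near the origin, uniformly in β -/

theorem norm_weylSum_le (N : ℕ) (x t : ℝ) : ‖weylSum N x t‖ ≤ N := by
  rw [weylSum_eq]
  refine (norm_sum_le _ _).trans ?_
  simp [norm_ex]

theorem norm_weylSum_neg (N : ℕ) (x t : ℝ) : ‖weylSum N (-x) (-t)‖ = ‖weylSum N x t‖ := by
  rw [← Complex.norm_conj, weylSum_eq, weylSum_eq, map_sum]
  congr 1
  refine Finset.sum_congr rfl fun n _ => ?_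
  rw [conj_ex]
  ring_nf

/-- Supplies the cut points of the second derivative test; the threshold defaults to M when P fails
throughout [1, M). -/
theorem exists_threshold (P : ℕ → Prop) (hP : ∀ m n, m ≤ n → P m → P n) (M : ℕ) (hM : 1 ≤ M) :
    ∃ m, 1 ≤ m ∧ m ≤ M ∧ (∀ n, 1 ≤ n → n < m → ¬ P n) ∧ ∀ n, m ≤ n → n < M → P n := by
  classical
  by_cases h : ∃ n, 1 ≤ n ∧ n < M ∧ P n
  · obtain ⟨h1, h2, h3⟩ := Nat.find_spec h
    exact ⟨Nat.find h, h1, h2.le, fun n hn hlt hn' =>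
      Nat.find_min h hlt ⟨hn, hlt.trans h2, hn'⟩, fun n hn _ => hP _ _ hn h3⟩
  · push Not at h
    exact ⟨M, hM, le_rfl, h, fun n h1 h2 => absurd h2 (by omega)⟩

/-- The second derivative test for a quadratic phase. -/
theorem norm_weylSum_le_of_pos {N : ℕ} (hN : 1 ≤ N) {γ β : ℝ} (hβ0 : 0 < β)
    (hγ : |γ| ≤ 1 / 2) (hβ : β ≤ 1 / (8 * N)) : ‖weylSum N γ β‖ ≤ 9 / √β := by
  have hN' : (1 : ℝ) ≤ N := by exact_mod_cast hN
  set s := √β with hs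
  have hs0 : 0 < s := Real.sqrt_pos.2 hβ0
  have hss : s * s = β := Real.mul_self_sqrt hβ0.le
  have hβN : β * N ≤ 1 / 8 := by
    rw [le_div_iff₀ (by positivity)] at hβ; linarith
  have hs1 : s ≤ 1 / 2 := by nlinarith
  have hg := abs_le.1 hγ
  have hmono : ∀ m n : ℕ, m ≤ n → γ + β * (2 * m + 1) ≤ γ + β * (2 * n + 1) := by
    intro m n h
    gcongr
  have hb : ∀ n : ℕ, n < N + 1 → β * (2 * n + 1) ≤ 3 / 8 := by
    intro n hn
    have : (n : ℝ) ≤ N := by exact_mod_cast (by omega : n ≤ N)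
    nlinarith
  have hb0 : ∀ n : ℕ, 0 ≤ β * (2 * n + 1) := fun n => by positivity
  -- The range is cut where the increasing increment passes -s/4 and s/4, with s = √β. The outer
  -- pieces have distance s/4 from the integers and cost 4/s each.
  obtain ⟨u, hu1, huN, hu, hu'⟩ := exists_threshold (fun n => -(s / 4) < γ + β * (2 * n + 1))
    (fun m n h hm => hm.trans_le (hmono m n h)) (N + 1) (by omega)
  obtain ⟨v, hv1, hvN, hv, hv'⟩ := exists_threshold (fun n => s / 4 ≤ γ + β * (2 * n + 1))
    (fun m n h hm => hm.trans (hmono m n h)) (N + 1) (by omega)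
  have huv : u ≤ v := by
    by_contra! h
    exact hu v hv1 h (by have := hv' v le_rfl (by omega); linarith)
  rw [weylSum_eq, ← Finset.Ico_add_one_right_eq_Icc,
    ← Finset.sum_Ico_consecutive _ (hu1.trans huv) hvN, ← Finset.sum_Ico_consecutive _ hu1 huv]
  have hs8 : s ≤ 3 / 8 := by nlinarith
  have h1 := kusmin_landau_quadratic γ β (-1) 1 u (δ := s / 4) (by positivity)
    (fun n h1 h2 => by have := hb0 n; push_cast; linarith)
    (fun n h1 h2 => by have := hu n h1 h2; push_cast; linarith)
  have h3 := kusmin_landau_quadratic γ β 0 v (N + 1) (δ := s / 4) (by positivity)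
    (fun n h1 h2 => by have := hv' n h1 h2; push_cast; linarith)
    (fun n h1 h2 => by have := hb n h2; push_cast; linarith)
  -- The middle piece is counted trivially: increments grow by 2β = 2s² per step inside a window of
  -- width s/2.
  have h2 : ‖∑ n ∈ Finset.Ico u v, ex (γ * n + β * n ^ 2)‖ ≤ 1 / s := by
    refine (norm_sum_le _ _).trans ?_
    simp only [norm_ex, Finset.sum_const, Nat.card_Ico, nsmul_eq_mul, mul_one]
    rcases Nat.eq_or_lt_of_le huv with rfl | hlt
    · simp [hs0.le]
    have e1 := hu' u le_rfl (by omega)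
    have e2 := hv (v - 1) (by omega) (by omega)
    have hc : ((v - 1 : ℕ) : ℝ) = v - 1 := by rw [Nat.cast_sub (by omega)]; simp
    rw [hc] at e2
    rw [Nat.cast_sub huv, le_div_iff₀ hs0]
    push Not at e2
    have e3 : s * ((v - u) * s) < s * (s + 1 / 4) := by nlinarith
    have := lt_of_mul_lt_mul_left e3 hs0.le
    linarith
  have e : 9 / s = 1 / (s / 4) + 1 / s + 1 / (s / 4) := by field_simp; norm_num
  rw [e]
  exact norm_add_le_of_le (norm_add_le_of_le h1 h2) h3

theorem norm_weylSum_le_of_abs {N : ℕ} (hN : 1 ≤ N) {γ β : ℝ} (hβ0 : β ≠ 0)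
    (hγ : |γ| ≤ 1 / 2) (hβ : |β| ≤ 1 / (8 * N)) : ‖weylSum N γ β‖ ≤ 9 / √|β| := by
  rcases lt_or_gt_of_ne hβ0 with h | h
  · rw [← norm_weylSum_neg, abs_of_neg h]
    rw [abs_of_neg h] at hβ
    exact norm_weylSum_le_of_pos hN (by linarith) (by rwa [abs_neg]) hβ
  · rw [abs_of_pos h] at hβ ⊢
    exact norm_weylSum_le_of_pos hN h hγ hβ

/-- Here γ dominates: the increments keep its sign and have size between |γ|/4 and 7|γ|/4 ≤ 1 -
|γ|/4. -/
theorem norm_weylSum_le_four_div {N : ℕ} {γ β : ℝ} (hγ0 : 0 < |γ|)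
    (hγ : |γ| ≤ 1 / 2) (hβ : 4 * N * |β| ≤ |γ|) : ‖weylSum N γ β‖ ≤ 4 / |γ| := by
  have hb : ∀ n : ℕ, 1 ≤ n → n < N + 1 → |β * (2 * n + 1)| ≤ 3 / 4 * |γ| := by
    intro n h1 hn
    rw [abs_mul, abs_of_nonneg (by positivity : (0 : ℝ) ≤ 2 * n + 1)]
    have h1' : (1 : ℝ) ≤ n := by exact_mod_cast h1
    have : (n : ℝ) ≤ N := by exact_mod_cast (by omega : n ≤ N)
    nlinarith [abs_nonneg β]
  rw [weylSum_eq, ← Finset.Ico_add_one_right_eq_Icc,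
    show 4 / |γ| = 1 / (|γ| / 4) by field_simp]
  rcases le_total 0 γ with h | h
  · rw [abs_of_nonneg h] at *
    refine kusmin_landau_quadratic γ β 0 1 (N + 1) (by positivity) ?_ ?_ <;>
    · intro n h1 h2
      have := abs_le.1 (hb n h1 h2)
      push_cast
      linarith [this.1, this.2]
  · rw [abs_of_nonpos h] at *
    refine kusmin_landau_quadratic γ β (-1) 1 (N + 1) (by linarith) ?_ ?_ <;>
    · intro n h1 h2
      have := abs_le.1 (hb n h1 h2)
      push_cast
      linarith [this.1, this.2]

/-- Three regimes: the trivial bound if N|γ| ≤ 1, Kusmin–Landau if 4N|β| ≤ |γ|, and otherwise the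
second derivative test, where 1/|β| < 4N/|γ|. The absence of β from the result is what permits a
maximum over t. -/
theorem norm_weylSum_sq_mul_le {N : ℕ} (hN : 1 ≤ N) {γ β : ℝ}
    (hγ : |γ| ≤ 1 / 2) (hβ : |β| ≤ 1 / (8 * N)) :
    ‖weylSum N γ β‖ ^ 2 * (1 + N * |γ|) ≤ 648 * (N : ℝ) ^ 2 := by
  have hN' : (1 : ℝ) ≤ N := by exact_mod_cast hN
  have h0 := norm_weylSum_le N γ β
  have hT := norm_nonneg (weylSum N γ β)
  have hg0 := abs_nonneg γ
  have hTT : ‖weylSum N γ β‖ ^ 2 ≤ (N : ℝ) ^ 2 := by gcongr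
  rcases le_or_gt (N * |γ|) 1 with h1 | h1
  · have : (0 : ℝ) ≤ N * |γ| := by positivity
    nlinarith [sq_nonneg ‖weylSum N γ β‖]
  have hgpos : 0 < |γ| := by
    rcases hg0.lt_or_eq with h | h
    · exact h
    · rw [← h] at h1; norm_num at h1
  have hle : ‖weylSum N γ β‖ ^ 2 * (1 + N * |γ|) ≤ ‖weylSum N γ β‖ ^ 2 * (2 * N * |γ|) := by
    gcongr; linarith
  refine hle.trans ?_
  rcases le_or_gt (4 * N * |β|) |γ| with h2 | h2
  · have h := norm_weylSum_le_four_div hgpos hγ h2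
    rw [le_div_iff₀ hgpos] at h
    calc _ = 2 * N * (‖weylSum N γ β‖ * (‖weylSum N γ β‖ * |γ|)) := by ring
      _ ≤ 2 * N * (N * 4) := by gcongr
      _ ≤ _ := by nlinarith
  · have hb0 : β ≠ 0 := by
      rintro rfl
      simp at h2
      linarith
    have h := norm_weylSum_le_of_abs hN hb0 hγ hβ
    have hbpos : 0 < |β| := abs_pos.2 hb0
    have h3 : ‖weylSum N γ β‖ ^ 2 ≤ 81 / |β| := by
      calc _ ≤ (9 / √|β|) ^ 2 := by gcongr
        _ = _ := by rw [div_pow, Real.sq_sqrt hbpos.le]; norm_num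
    rw [le_div_iff₀ hbpos] at h3
    calc _ ≤ ‖weylSum N γ β‖ ^ 2 * (2 * N * (4 * N * |β|)) := by gcongr
      _ = 8 * (N : ℝ) ^ 2 * (‖weylSum N γ β‖ ^ 2 * |β|) := by ring
      _ ≤ 8 * (N : ℝ) ^ 2 * 81 := by gcongr
      _ = _ := by ring

theorem norm_weylSum_le_rpow {N : ℕ} (hN : 1 ≤ N) {γ β : ℝ}
    (hγ : |γ| ≤ 1 / 2) (hβ : |β| ≤ 1 / (8 * N)) :
    ‖weylSum N γ β‖ ≤ 26 * N * (1 + N * |γ|) ^ (-(1 / 2) : ℝ) := by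
  have h := norm_weylSum_sq_mul_le hN hγ hβ
  have hpos : 0 < 1 + N * |γ| := by positivity
  have hu : ((1 + N * |γ|) ^ (-(1 / 2) : ℝ)) ^ 2 * (1 + N * |γ|) = 1 := by
    rw [← Real.rpow_natCast, ← Real.rpow_mul hpos.le]
    norm_num
    rw [Real.rpow_neg_one, inv_mul_cancel₀ hpos.ne']
  refine (abs_le_of_sq_le_sq' ?_ (by positivity)).2
  refine le_of_mul_le_mul_right (h.trans ?_) hpos
  rw [mul_pow, mul_assoc, hu]
  nlinarith [sq_nonneg (N : ℝ)]

/-! ### Pointwise upper bound for the maximal function -/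

/-- The upper bound for one sum: either it is at most of order `N^{3/4}`, or `x` is near a fraction
with small denominator. -/
theorem norm_weylSum_le_major {N : ℕ} (hN : 1 ≤ N) {x : ℝ} (hx0 : 0 ≤ x) (hx1 : x ≤ 1) (t : ℝ) :
    ‖weylSum N x t‖ ≤ 700 * (N : ℝ) ^ (3 / 4 : ℝ) ∨
    ∃ q b : ℕ, 1 ≤ q ∧ q ^ 2 ≤ N ∧ b ≤ q ∧ ‖weylSum N x t‖ ≤ 120 * (N : ℝ) ^ (3 / 4 : ℝ) +
      39 * ((q : ℝ) ^ (-(1 / 2) : ℝ) * (N * (1 + N * |x - b / q|) ^ (-(1 / 2) : ℝ))) := by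
  have hN' : (1 : ℝ) ≤ N := by exact_mod_cast hN
  -- Order 8N is chosen to give |t - r| ≤ 1/(8qN), while keeping q ≤ 8N so that the error q^{3/4} is
  -- O(N^{3/4}).
  obtain ⟨r, hr, hrN⟩ := Real.exists_rat_abs_sub_le_and_den_le t (n := 8 * N) (by omega)
  set q := r.den with hqdef
  have hq1 : 1 ≤ q := r.pos
  have hq0 : (1 : ℝ) ≤ q := by exact_mod_cast hq1
  have : NeZero q := ⟨by omega⟩
  have ha : IsUnit ((r.num : ℤ) : ZMod q) := by
    rw [ZMod.coe_int_isUnit_iff_isCoprime]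
    have := r.reduced
    rw [Int.isCoprime_iff_gcd_eq_one, Int.gcd_comm]
    exact this
  set β := t - r with hβdef
  have hβ : |β| ≤ 1 / (8 * q * N) := by
    refine hr.trans ?_
    push_cast
    exact one_div_le_one_div_of_le (by positivity) (by nlinarith)
  have hrq : (r : ℝ) = r.num / q := Rat.cast_def r
  set b := round (q * x) with hbdef
  set γ := x - b / q with hγdef
  have hγ : |γ| ≤ 1 / (2 * q) := by
    have h := abs_sub_round (q * x)
    have e : γ = (q * x - b) / q := by rw [hγdef]; field_simp
    rw [e, abs_div, abs_of_pos (by positivity : (0 : ℝ) < q), div_le_div_iff₀ (by positivity)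
      (by positivity)]
    nlinarith
  have hγ2 : |γ| ≤ 1 / 2 := hγ.trans (by gcongr; linarith)
  have hβ2 : |β| ≤ 1 / (8 * N) := hβ.trans (by gcongr; linarith)
  have key := norm_weylSum_sub_le ha b hN hγ hβ
  rw [show (b / q + γ : ℝ) = x by rw [hγdef]; ring,
    show (r.num / q + β : ℝ) = t by rw [hβdef, hrq]; ring] at key
  have hT := norm_weylSum_le_rpow hN hγ2 hβ2
  have hG : ‖quadGauss q (r.num : ZMod q) (b : ZMod q) / q‖ ≤
      3 / 2 * (q : ℝ) ^ (-(1 / 2) : ℝ) := by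
    have h := norm_quadGauss_sq_le q ha (b : ZMod q)
    have h2 : ‖quadGauss q (r.num : ZMod q) (b : ZMod q)‖ ≤ 3 / 2 * √q := by
      refine abs_le_of_sq_le_sq' ?_ (by positivity) |>.2
      rw [mul_pow, Real.sq_sqrt (by positivity)]
      linarith
    rw [norm_div, Complex.norm_natCast, div_le_iff₀ (by positivity)]
    refine h2.trans_eq ?_
    rw [mul_assoc, ← Real.rpow_add_one (by positivity), Real.sqrt_eq_rpow]
    norm_num
  have hmain : ‖weylSum N x t‖ ≤ 120 * (q : ℝ) ^ (3 / 4 : ℝ) +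
      39 * ((q : ℝ) ^ (-(1 / 2) : ℝ) * (N * (1 + N * |γ|) ^ (-(1 / 2) : ℝ))) := by
    calc ‖weylSum N x t‖ ≤ _ + ‖quadGauss q (r.num : ZMod q) (b : ZMod q) / q *
          weylSum N γ β‖ := norm_le_norm_sub_add _ _
      _ ≤ 120 * (q : ℝ) ^ (3 / 4 : ℝ) + 3 / 2 * (q : ℝ) ^ (-(1 / 2) : ℝ) *
          (26 * N * (1 + N * |γ|) ^ (-(1 / 2) : ℝ)) := by
          rw [norm_mul]; gcongr
      _ = _ := by ring
  have hq34 : q ≤ N → (q : ℝ) ^ (3 / 4 : ℝ) ≤ (N : ℝ) ^ (3 / 4 : ℝ) := by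
    intro h; gcongr
  have hround : ∀ u v : ℝ, u ≤ v → round u ≤ round v := fun u v h => by
    rw [round_eq, round_eq]; exact Int.floor_mono (by linarith)
  by_cases hqN : q ^ 2 ≤ N
  · right
    have hqx0 : 0 ≤ (q : ℝ) * x := by positivity
    have hb0 : 0 ≤ b := by
      have h := hround _ _ hqx0
      rwa [round_zero] at h
    have hbq : b ≤ q := by
      have h : round ((q : ℝ) * x) ≤ round ((q : ℝ)) := hround _ _ (by nlinarith)
      rwa [round_natCast] at h
    obtain ⟨b', hb'⟩ := Int.eq_ofNat_of_zero_le hb0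
    have hbc : (b' : ℝ) = (b : ℝ) := by rw [hb']; simp
    refine ⟨q, b', hq1, hqN, by omega, ?_⟩
    rw [hbc]
    refine hmain.trans ?_
    gcongr
    nlinarith
  -- For q > √N the main term is already at most of order N q^{-1/2} ≤ N^{3/4}.
  · left
    have hqN' : (N : ℝ) ≤ (q : ℝ) ^ 2 := by exact_mod_cast (not_le.1 hqN).le
    have h1 : (q : ℝ) ^ (-(1 / 2) : ℝ) ≤ (N : ℝ) ^ (-(1 / 4) : ℝ) := by
      calc (q : ℝ) ^ (-(1 / 2) : ℝ) = ((q : ℝ) ^ 2) ^ (-(1 / 4) : ℝ) := by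
            rw [← Real.rpow_natCast, ← Real.rpow_mul (by positivity)]; norm_num
        _ ≤ _ := Real.rpow_le_rpow_of_nonpos (by positivity) hqN' (by norm_num)
    have h2 : (1 + N * |γ|) ^ (-(1 / 2) : ℝ) ≤ 1 :=
      Real.rpow_le_one_of_one_le_of_nonpos (by have : 0 ≤ N * |γ| := by positivity
                                               linarith) (by norm_num)
    have h3 : (q : ℝ) ^ (3 / 4 : ℝ) ≤ 5 * (N : ℝ) ^ (3 / 4 : ℝ) := by
      calc (q : ℝ) ^ (3 / 4 : ℝ) ≤ ((8 * N : ℝ)) ^ (3 / 4 : ℝ) := by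
            gcongr; exact_mod_cast hrN
        _ = (8 : ℝ) ^ (3 / 4 : ℝ) * (N : ℝ) ^ (3 / 4 : ℝ) := by
            rw [Real.mul_rpow (by norm_num) (by positivity)]
        _ ≤ _ := by
            gcongr
            calc (8 : ℝ) ^ (3 / 4 : ℝ) = ((8 : ℝ) ^ 3) ^ (1 / 4 : ℝ) := by
                  rw [← Real.rpow_natCast, ← Real.rpow_mul (by norm_num)]; norm_num
              _ ≤ ((5 : ℝ) ^ 4) ^ (1 / 4 : ℝ) := by gcongr; norm_num
              _ = 5 := by
                  rw [← Real.rpow_natCast, ← Real.rpow_mul (by norm_num)]; norm_num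
    have h4 : (N : ℝ) ^ (-(1 / 4) : ℝ) * N = (N : ℝ) ^ (3 / 4 : ℝ) := by
      rw [← Real.rpow_add_one (by positivity)]; norm_num
    have h5 : 0 ≤ (N : ℝ) ^ (3 / 4 : ℝ) := by positivity
    calc _ ≤ _ := hmain
      _ ≤ 120 * (5 * (N : ℝ) ^ (3 / 4 : ℝ)) + 39 * ((N : ℝ) ^ (-(1 / 4) : ℝ) * (N * 1)) := by
          gcongr
      _ ≤ _ := by rw [mul_one, h4]; linarith

theorem exists_weylMax_eq {p : ℝ} (hp : 0 ≤ p) (N : ℕ) (x : ℝ) :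
    ∃ t : ℝ, weylMax p N x = ‖weylSum N x t‖ ^ p := by
  obtain ⟨t, -, h⟩ := (isGreatest_weylMax hp N x).1
  exact ⟨t, h.symm⟩

theorem le_weylMax {p : ℝ} (hp : 0 ≤ p) (N : ℕ) (x : ℝ) {t : ℝ} (h0 : 0 ≤ t) (h1 : t ≤ 1) :
    ‖weylSum N x t‖ ^ p ≤ weylMax p N x :=
  (isGreatest_weylMax hp N x).2 ⟨t, ⟨h0, h1⟩, rfl⟩

theorem weylMax_nonneg {p : ℝ} (hp : 0 ≤ p) (N : ℕ) (x : ℝ) : 0 ≤ weylMax p N x := by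
  obtain ⟨t, h⟩ := exists_weylMax_eq hp N x
  rw [h]; positivity

theorem add_rpow_le_two_rpow {p u v : ℝ} (hp : 0 ≤ p) (hu : 0 ≤ u) (hv : 0 ≤ v) :
    (u + v) ^ p ≤ (2 * u) ^ p + (2 * v) ^ p := by
  have h1 : 0 ≤ (2 * u) ^ p := by positivity
  have h2 : 0 ≤ (2 * v) ^ p := by positivity
  rcases le_total u v with h | h
  · have : (u + v) ^ p ≤ (2 * v) ^ p := by gcongr; linarith
    linarith
  · have : (u + v) ^ p ≤ (2 * u) ^ p := by gcongr; linarith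
    linarith

/-- The fraction b/q depends on the maximizing t, so its peak is replaced by the sum of all
candidate peaks, which are nonnegative. The constants 700, 120 and 39 double when p-th powers are
split; 1400 covers both first terms. -/
theorem weylMax_le {p : ℝ} (hp : 0 ≤ p) {N : ℕ} (hN : 1 ≤ N) {x : ℝ} (hx0 : 0 ≤ x)
    (hx1 : x ≤ 1) :
    weylMax p N x ≤ 1400 ^ p * (N : ℝ) ^ (3 * p / 4) +
      ∑ q ∈ Finset.Icc 1 N.sqrt, ∑ b ∈ Finset.range (q + 1),
        78 ^ p * (q : ℝ) ^ (-(p / 2)) * (N : ℝ) ^ p * (1 + N * |x - b / q|) ^ (-(p / 2)) := by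
  obtain ⟨t, ht⟩ := exists_weylMax_eq hp N x
  rw [ht]
  have hN34 : ∀ c : ℝ, 0 ≤ c → (c * (N : ℝ) ^ (3 / 4 : ℝ)) ^ p = c ^ p * (N : ℝ) ^ (3 * p / 4) := by
    intro c hc
    rw [Real.mul_rpow hc (by positivity), ← Real.rpow_mul (by positivity)]
    ring_nf
  have hterm : ∀ q b : ℕ, 0 ≤ 78 ^ p * (q : ℝ) ^ (-(p / 2)) * (N : ℝ) ^ p *
      (1 + N * |x - b / q|) ^ (-(p / 2)) := fun q b => by positivity
  rcases norm_weylSum_le_major hN hx0 hx1 t with h | ⟨q, b, hq, hqN, hb, h⟩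
  · have h1 : ‖weylSum N x t‖ ^ p ≤ 1400 ^ p * (N : ℝ) ^ (3 * p / 4) := by
      rw [← hN34 1400 (by norm_num)]
      have h0 : 0 ≤ (N : ℝ) ^ (3 / 4 : ℝ) := by positivity
      gcongr
      linarith
    have h2 : 0 ≤ ∑ q ∈ Finset.Icc 1 N.sqrt, ∑ b ∈ Finset.range (q + 1),
        78 ^ p * (q : ℝ) ^ (-(p / 2)) * (N : ℝ) ^ p * (1 + N * |x - b / q|) ^ (-(p / 2)) :=
      Finset.sum_nonneg fun q _ => Finset.sum_nonneg fun b _ => hterm q b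
    linarith
  · have h1 : ‖weylSum N x t‖ ^ p ≤ 240 ^ p * (N : ℝ) ^ (3 * p / 4) +
        78 ^ p * (q : ℝ) ^ (-(p / 2)) * (N : ℝ) ^ p * (1 + N * |x - b / q|) ^ (-(p / 2)) := by
      calc _ ≤ _ := Real.rpow_le_rpow (norm_nonneg _) h hp
        _ ≤ _ := add_rpow_le_two_rpow hp (by positivity) (by positivity)
        _ = _ := by
          congr 1
          · rw [← mul_assoc, hN34 _ (by norm_num)]; norm_num
          · rw [← mul_assoc, show (2 * 39 : ℝ) = 78 by norm_num,
              Real.mul_rpow (by norm_num) (by positivity),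
              Real.mul_rpow (by positivity) (by positivity),
              Real.mul_rpow (by positivity) (by positivity), ← Real.rpow_mul (by positivity),
              ← Real.rpow_mul (by positivity)]
            ring_nf
    refine h1.trans (add_le_add (by gcongr; norm_num) ?_)
    have hq' : q ∈ Finset.Icc 1 N.sqrt := Finset.mem_Icc.2 ⟨hq, Nat.le_sqrt'.2 hqN⟩
    have hb' : b ∈ Finset.range (q + 1) := Finset.mem_range.2 (by omega)
    refine le_trans ?_ (Finset.single_le_sum
      (fun q _ => Finset.sum_nonneg fun b _ => hterm q b) hq')
    exact Finset.single_le_sum (f := fun b : ℕ => 78 ^ p * (q : ℝ) ^ (-(p / 2)) * (N : ℝ) ^ p *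
      (1 + N * |x - b / q|) ^ (-(p / 2))) (fun b _ => hterm q b) hb'

/-! ### Upper bounds for the moments -/

theorem integral_peak_le {r : ℝ} (hr : 1 < r) {N : ℕ} (hN : 1 ≤ N) (y : ℝ) :
    ∫ x in (0 : ℝ)..1, (1 + N * |x - y|) ^ (-r) ≤ (∫ u : ℝ, (1 + ‖u‖) ^ (-r)) / N := by
  have hN' : (0 : ℝ) < N := by exact_mod_cast hN
  have hi : MeasureTheory.Integrable fun u : ℝ => (1 + ‖u‖) ^ (-r) :=
    integrable_one_add_norm (by simpa using hr)
  have e : (fun x : ℝ => (1 + N * |x - y|) ^ (-r)) = fun x => (1 + ‖N * (x - y)‖) ^ (-r) := by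
    funext x
    rw [Real.norm_eq_abs, abs_mul, abs_of_pos hN']
  have hi2 : MeasureTheory.Integrable fun x : ℝ => (1 + ‖N * (x - y)‖) ^ (-r) :=
    (hi.comp_mul_left' hN'.ne').comp_sub_right y
  rw [e, intervalIntegral.integral_of_le zero_le_one]
  refine (MeasureTheory.setIntegral_le_integral hi2
    (Filter.Eventually.of_forall fun x => by positivity)).trans_eq ?_
  rw [MeasureTheory.integral_sub_right_eq_self (fun x : ℝ => (1 + ‖N * x‖) ^ (-r)) y,
    MeasureTheory.Measure.integral_comp_mul_left (fun x : ℝ => (1 + ‖x‖) ^ (-r)) (N : ℝ),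
    abs_of_pos (inv_pos.2 hN'), smul_eq_mul]
  ring

theorem continuous_peak {r : ℝ} {N : ℕ} (y : ℝ) :
    Continuous fun x : ℝ => (1 + N * |x - y|) ^ (-r) := by
  refine Continuous.rpow_const (by fun_prop) fun x => Or.inl ?_
  positivity

/-- Each peak has integral O(1/N), because p/2 > 1 makes it integrable on the line, and each q has q
+ 1 ≤ 2q numerators. -/
theorem exists_weylMoment_le {p : ℝ} (hp : 2 < p) : ∃ C : ℝ, 0 < C ∧ ∀ N : ℕ, 1 ≤ N →
    weylMoment p N ≤ C * ((N : ℝ) ^ (3 * p / 4) +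
      (N : ℝ) ^ (p - 1) * ∑ q ∈ Finset.Icc 1 N.sqrt, (q : ℝ) ^ (1 - p / 2)) := by
  set K : ℝ := ∫ u : ℝ, (1 + ‖u‖) ^ (-(p / 2)) with hK
  have hK0 : 0 ≤ K := MeasureTheory.integral_nonneg fun u => by positivity
  refine ⟨1400 ^ p + 78 ^ p * (2 * K), by positivity, fun N hN => ?_⟩
  have hN' : (0 : ℝ) < N := by exact_mod_cast hN
  have hcont : ∀ q b : ℕ, Continuous fun x : ℝ => 78 ^ p * (q : ℝ) ^ (-(p / 2)) * (N : ℝ) ^ p *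
      (1 + N * |x - b / q|) ^ (-(p / 2)) := fun q b => continuous_const.mul (continuous_peak _)
  have hcont2 : Continuous fun x : ℝ => ∑ q ∈ Finset.Icc 1 N.sqrt, ∑ b ∈ Finset.range (q + 1),
        78 ^ p * (q : ℝ) ^ (-(p / 2)) * (N : ℝ) ^ p * (1 + N * |x - b / q|) ^ (-(p / 2)) :=
    continuous_finsetSum _ fun q _ => continuous_finsetSum _ fun b _ => hcont q b
  have h1 : weylMoment p N ≤ ∫ x in (0 : ℝ)..1, (1400 ^ p * (N : ℝ) ^ (3 * p / 4) +
      ∑ q ∈ Finset.Icc 1 N.sqrt, ∑ b ∈ Finset.range (q + 1),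
        78 ^ p * (q : ℝ) ^ (-(p / 2)) * (N : ℝ) ^ p * (1 + N * |x - b / q|) ^ (-(p / 2))) :=
    intervalIntegral.integral_mono_on zero_le_one (intervalIntegrable_weylMax (by linarith) N)
      ((continuous_const.add hcont2).intervalIntegrable _ _)
      fun x hx => weylMax_le (by linarith) hN hx.1 hx.2
  have h2 : ∀ q ∈ Finset.Icc 1 N.sqrt, (∫ x in (0 : ℝ)..1, ∑ b ∈ Finset.range (q + 1),
        78 ^ p * (q : ℝ) ^ (-(p / 2)) * (N : ℝ) ^ p * (1 + N * |x - b / q|) ^ (-(p / 2))) ≤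
      78 ^ p * (2 * K) * ((N : ℝ) ^ (p - 1) * (q : ℝ) ^ (1 - p / 2)) := by
    intro q hq
    have hq1 : (1 : ℝ) ≤ q := by exact_mod_cast (Finset.mem_Icc.1 hq).1
    rw [intervalIntegral.integral_finsetSum fun b _ => (hcont q b).intervalIntegrable _ _]
    have h3 : ∀ b ∈ Finset.range (q + 1), (∫ x in (0 : ℝ)..1, 78 ^ p * (q : ℝ) ^ (-(p / 2)) *
        (N : ℝ) ^ p * (1 + N * |x - b / q|) ^ (-(p / 2))) ≤
        78 ^ p * (q : ℝ) ^ (-(p / 2)) * (N : ℝ) ^ p * (K / N) := by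
      intro b _
      rw [intervalIntegral.integral_const_mul]
      gcongr
      exact integral_peak_le (by linarith) hN _
    refine (Finset.sum_le_sum h3).trans ?_
    rw [Finset.sum_const, Finset.card_range, nsmul_eq_mul, Real.rpow_sub_one hN'.ne',
      show 1 - p / 2 = -(p / 2) + 1 by ring, Real.rpow_add_one (by positivity)]
    calc ((q + 1 : ℕ) : ℝ) * (78 ^ p * (q : ℝ) ^ (-(p / 2)) * (N : ℝ) ^ p * (K / N)) ≤
        (2 * q) * (78 ^ p * (q : ℝ) ^ (-(p / 2)) * (N : ℝ) ^ p * (K / N)) := by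
          gcongr; push_cast; linarith
      _ = _ := by ring
  rw [intervalIntegral.integral_add (by simp) (hcont2.intervalIntegrable _ _),
    intervalIntegral.integral_const, intervalIntegral.integral_finsetSum fun q _ =>
      (continuous_finsetSum _ fun b _ => hcont q b).intervalIntegrable _ _] at h1
  refine h1.trans ((add_le_add_right (Finset.sum_le_sum h2) _).trans ?_)
  rw [← Finset.mul_sum, ← Finset.mul_sum, sub_zero, one_smul]
  have e1 : 0 ≤ 78 ^ p * (2 * K) * (N : ℝ) ^ (3 * p / 4) := by positivity
  have e2 : 0 ≤ 1400 ^ p * ((N : ℝ) ^ (p - 1) *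
    ∑ q ∈ Finset.Icc 1 N.sqrt, (q : ℝ) ^ (1 - p / 2)) := by positivity
  linarith

theorem sum_rpow_neg_le {α : ℝ} (h0 : 0 ≤ α) (h1 : α < 1) (Q : ℕ) :
    ∑ q ∈ Finset.Icc 1 Q, (q : ℝ) ^ (-α) ≤ (Q : ℝ) ^ (1 - α) / (1 - α) := by
  have hα : 0 < 1 - α := by linarith
  induction Q with
  | zero => simp [Real.zero_rpow hα.ne']
  | succ n ih =>
    rw [Finset.sum_Icc_succ_top (by omega)]
    refine (add_le_add_left ih _).trans ?_
    rw [← sub_nonneg]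
    have hn : (0 : ℝ) < ((n + 1 : ℕ) : ℝ) := by positivity
    -- Bernoulli's inequality for the concave power 1 - α bounds n^{1-α} by its tangent at n + 1,
    -- which is the induction step.
    have hb := rpow_one_add_le_one_add_mul_self (s := -1 / ((n + 1 : ℕ) : ℝ)) (p := 1 - α)
      (by rw [le_div_iff₀ hn]; push_cast; nlinarith [(Nat.cast_nonneg n : (0 : ℝ) ≤ n)])
      hα.le (by linarith)
    have e1 : (n : ℝ) = ((n + 1 : ℕ) : ℝ) * (1 + -1 / ((n + 1 : ℕ) : ℝ)) := by
      field_simp; push_cast; ring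
    have e2 : 0 ≤ 1 + -1 / ((n + 1 : ℕ) : ℝ) := by
      have : (0 : ℝ) ≤ n := Nat.cast_nonneg n
      rw [e1] at this
      exact nonneg_of_mul_nonneg_right this hn
    have e3 : (n : ℝ) ^ (1 - α) ≤ ((n + 1 : ℕ) : ℝ) ^ (1 - α) *
        (1 + (1 - α) * (-1 / ((n + 1 : ℕ) : ℝ))) := by
      conv_lhs => rw [e1]
      rw [Real.mul_rpow hn.le e2]
      gcongr
    have e4 : ((n + 1 : ℕ) : ℝ) ^ (1 - α) = ((n + 1 : ℕ) : ℝ) ^ (-α) * ((n + 1 : ℕ) : ℝ) := by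
      rw [← Real.rpow_add_one hn.ne']; ring_nf
    have e5 : ((n + 1 : ℕ) : ℝ) ^ (1 - α) * (1 + (1 - α) * (-1 / ((n + 1 : ℕ) : ℝ))) =
        ((n + 1 : ℕ) : ℝ) ^ (1 - α) - (1 - α) * ((n + 1 : ℕ) : ℝ) ^ (-α) := by
      rw [e4]; field_simp; ring
    rw [e5] at e3
    have e6 : ((n + 1 : ℕ) : ℝ) ^ (1 - α) / (1 - α) - ((n : ℝ) ^ (1 - α) / (1 - α) +
        ((n + 1 : ℕ) : ℝ) ^ (-α)) = (((n + 1 : ℕ) : ℝ) ^ (1 - α) -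
          (1 - α) * ((n + 1 : ℕ) : ℝ) ^ (-α) - (n : ℝ) ^ (1 - α)) / (1 - α) := by
      field_simp
      ring
    rw [e6]
    exact div_nonneg (by linarith) hα.le

theorem sqrt_cast_le_rpow (N : ℕ) : ((N.sqrt : ℕ) : ℝ) ≤ (N : ℝ) ^ (1 / 2 : ℝ) := by
  rw [← Real.sqrt_eq_rpow]
  exact Real.nat_sqrt_le_real_sqrt

theorem exists_weylMoment_le_of_two_lt_of_lt_four {p : ℝ} (hp : 2 < p) (hp4 : p < 4) :
    ∃ C : ℝ, 0 < C ∧ ∀ N : ℕ, 1 ≤ N → weylMoment p N ≤ C * (N : ℝ) ^ (3 * p / 4) := by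
  obtain ⟨C, hC, h⟩ := exists_weylMoment_le hp
  have hα : 0 < 2 - p / 2 := by linarith
  refine ⟨C * (1 + 1 / (2 - p / 2)), by positivity, fun N hN => (h N hN).trans ?_⟩
  have hN' : (0 : ℝ) < N := by exact_mod_cast hN
  have h1 := sum_rpow_neg_le (α := p / 2 - 1) (by linarith) (by linarith) N.sqrt
  rw [show -(p / 2 - 1) = 1 - p / 2 by ring, show 1 - (p / 2 - 1) = 2 - p / 2 by ring] at h1
  have h2 : ((N.sqrt : ℕ) : ℝ) ^ (2 - p / 2) ≤ (N : ℝ) ^ (1 - p / 4) := by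
    calc _ ≤ ((N : ℝ) ^ (1 / 2 : ℝ)) ^ (2 - p / 2) := by gcongr; exact sqrt_cast_le_rpow N
      _ = _ := by rw [← Real.rpow_mul hN'.le]; ring_nf
  have h3 : (N : ℝ) ^ (p - 1) * (N : ℝ) ^ (1 - p / 4) = (N : ℝ) ^ (3 * p / 4) := by
    rw [← Real.rpow_add hN']; ring_nf
  rw [mul_assoc]
  refine mul_le_mul_of_nonneg_left ?_ hC.le
  calc _ ≤ (N : ℝ) ^ (3 * p / 4) + (N : ℝ) ^ (p - 1) * ((N : ℝ) ^ (1 - p / 4) / (2 - p / 2)) := by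
        gcongr
        exact h1.trans (by gcongr)
    _ = _ := by rw [← mul_div_assoc, h3]; ring

/-- Peaks are not integrable for p ≤ 2, so an exponent s in (2, 4) is used instead. With A =
N^{3/4}, y^p ≤ A^p + A^{p-s} y^s, and the s-th moment is O(A^s). -/
theorem exists_weylMoment_le_of_lt_four {p : ℝ} (hp : 1 ≤ p) (hp4 : p < 4) :
    ∃ C : ℝ, 0 < C ∧ ∀ N : ℕ, 1 ≤ N → weylMoment p N ≤ C * (N : ℝ) ^ (3 * p / 4) := by
  set s : ℝ := (p + 4) / 2 with hs
  obtain ⟨C, hC, h⟩ := exists_weylMoment_le_of_two_lt_of_lt_four (p := s) (by linarith)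
    (by linarith)
  refine ⟨1 + C, by positivity, fun N hN => ?_⟩
  have hN' : (0 : ℝ) < N := by exact_mod_cast hN
  have hmax : ∀ x, weylMax p N x ≤
      (N : ℝ) ^ (3 * p / 4) + (N : ℝ) ^ (3 * p / 4 - 3 * s / 4) * weylMax s N x := by
    intro x
    obtain ⟨t, ht0, ht⟩ := (isGreatest_weylMax (p := p) (by linarith) N x).1
    have h2 := le_weylMax (p := s) (by linarith) N x ht0.1 ht0.2
    simp only at ht
    rw [← ht]
    set y := ‖weylSum N x t‖ with hy
    have hy0 : 0 ≤ y := norm_nonneg _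
    set A : ℝ := (N : ℝ) ^ (3 / 4 : ℝ) with hA
    have hA0 : 0 < A := by positivity
    have hAp : ∀ r : ℝ, (N : ℝ) ^ (3 * r / 4) = A ^ r := by
      intro r; rw [hA, ← Real.rpow_mul hN'.le]; ring_nf
    rw [show 3 * p / 4 - 3 * s / 4 = 3 * (p - s) / 4 by ring, hAp, hAp]
    have hyA : y = A * (y / A) := by field_simp
    rcases le_total (y / A) 1 with h1 | h1
    · have : y ^ p ≤ A ^ p := by
        gcongr
        rwa [div_le_one hA0] at h1
      have : 0 ≤ A ^ (p - s) * weylMax s N x :=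
        mul_nonneg (by positivity) (weylMax_nonneg (by linarith) N x)
      linarith
    · have : y ^ p ≤ A ^ (p - s) * y ^ s := by
        have e : A ^ (p - s) * y ^ s = A ^ p * (y / A) ^ s := by
          rw [Real.rpow_sub hA0, Real.div_rpow hy0 hA0.le]; ring
        rw [e]
        calc y ^ p = A ^ p * (y / A) ^ p := by
              rw [← Real.mul_rpow hA0.le (by positivity), ← hyA]
          _ ≤ _ := by
              gcongr ?_ * ?_
              exact Real.rpow_le_rpow_of_exponent_le h1 (by linarith)
      have : 0 ≤ A ^ p := by positivity
      have : A ^ (p - s) * y ^ s ≤ A ^ (p - s) * weylMax s N x := by gcongr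
      linarith
  have hc := (continuous_weylMax (p := s) (by linarith) N).const_mul
    ((N : ℝ) ^ (3 * p / 4 - 3 * s / 4))
  have h1 : weylMoment p N ≤ ∫ x in (0 : ℝ)..1, ((N : ℝ) ^ (3 * p / 4) +
      (N : ℝ) ^ (3 * p / 4 - 3 * s / 4) * weylMax s N x) :=
    intervalIntegral.integral_mono_on zero_le_one (intervalIntegrable_weylMax (by linarith) N)
      ((continuous_const.add hc).intervalIntegrable _ _)
      fun x _ => hmax x
  rw [intervalIntegral.integral_add (by simp) (hc.intervalIntegrable _ _),
    intervalIntegral.integral_const, intervalIntegral.integral_const_mul, sub_zero, one_smul] at h1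
  have h2 : (N : ℝ) ^ (3 * p / 4 - 3 * s / 4) * (∫ x in (0 : ℝ)..1, weylMax s N x) ≤
      (N : ℝ) ^ (3 * p / 4 - 3 * s / 4) * (C * (N : ℝ) ^ (3 * s / 4)) := by
    gcongr
    exact h N hN
  have h3 : (N : ℝ) ^ (3 * p / 4 - 3 * s / 4) * (C * (N : ℝ) ^ (3 * s / 4)) =
      C * (N : ℝ) ^ (3 * p / 4) := by
    rw [mul_left_comm, ← Real.rpow_add hN']; ring_nf
  linarith

theorem exists_weylMoment_le_of_eq_four :
    ∃ C : ℝ, 0 < C ∧ ∀ N : ℕ, 2 ≤ N → weylMoment 4 N ≤ C * ((N : ℝ) ^ (3 : ℝ) * Real.log N) := by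
  obtain ⟨C, hC, h⟩ := exists_weylMoment_le (p := 4) (by norm_num)
  refine ⟨C * (1 + 2 / Real.log 2), by have := Real.log_pos one_lt_two; positivity,
    fun N hN => (h N (by omega)).trans ?_⟩
  have hN' : (2 : ℝ) ≤ N := by exact_mod_cast hN
  have hl2 := Real.log_pos one_lt_two
  have hlog : Real.log 2 ≤ Real.log N := Real.log_le_log (by norm_num) hN'
  have h1 : ∑ q ∈ Finset.Icc 1 N.sqrt, (q : ℝ) ^ (1 - 4 / 2 : ℝ) ≤ 1 + Real.log N := by
    have e1 := harmonic_le_one_add_log N.sqrt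
    rw [harmonic_eq_sum_Icc] at e1
    push_cast at e1
    have e2 : ∑ q ∈ Finset.Icc 1 N.sqrt, (q : ℝ) ^ (1 - 4 / 2 : ℝ) =
        ∑ q ∈ Finset.Icc 1 N.sqrt, (q : ℝ)⁻¹ := by
      refine Finset.sum_congr rfl fun q _ => ?_
      norm_num
      exact Real.rpow_neg_one _
    rw [e2]
    refine e1.trans ?_
    have hs : (1 : ℝ) ≤ (N.sqrt : ℕ) := by
      exact_mod_cast Nat.le_sqrt'.2 (by omega)
    have : Real.log (N.sqrt : ℕ) ≤ Real.log N :=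
      Real.log_le_log (by linarith) (by exact_mod_cast Nat.sqrt_le_self N)
    linarith
  have hone : 1 ≤ Real.log N / Real.log 2 := (one_le_div hl2).2 hlog
  rw [mul_assoc]
  refine mul_le_mul_of_nonneg_left ?_ hC.le
  calc _ ≤ (N : ℝ) ^ (3 * 4 / 4 : ℝ) + (N : ℝ) ^ (4 - 1 : ℝ) * (1 + Real.log N) := by gcongr
    _ = (N : ℝ) ^ (3 : ℝ) * (2 * 1 + Real.log N) := by norm_num; ring
    _ ≤ (N : ℝ) ^ (3 : ℝ) * (2 * (Real.log N / Real.log 2) + Real.log N) := by gcongr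
    _ = _ := by ring

theorem exists_weylMoment_le_of_four_lt {p : ℝ} (hp : 4 < p) :
    ∃ C : ℝ, 0 < C ∧ ∀ N : ℕ, 1 ≤ N → weylMoment p N ≤ C * (N : ℝ) ^ (p - 1) := by
  obtain ⟨C, hC, h⟩ := exists_weylMoment_le (p := p) (by linarith)
  have hs : Summable fun q : ℕ => (q : ℝ) ^ (1 - p / 2) := Real.summable_nat_rpow.2 (by linarith)
  have ht : 0 ≤ ∑' q : ℕ, (q : ℝ) ^ (1 - p / 2) := tsum_nonneg fun q => by positivity
  refine ⟨C * (1 + ∑' q : ℕ, (q : ℝ) ^ (1 - p / 2)), by positivity,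
    fun N hN => (h N (by omega)).trans ?_⟩
  have hN' : (1 : ℝ) ≤ N := by exact_mod_cast hN
  rw [mul_assoc]
  refine mul_le_mul_of_nonneg_left ?_ hC.le
  calc _ ≤ (N : ℝ) ^ (p - 1) + (N : ℝ) ^ (p - 1) * ∑' q : ℕ, (q : ℝ) ^ (1 - p / 2) := by
        gcongr ?_ + _ * ?_
        · exact Real.rpow_le_rpow_of_exponent_le hN' (by linarith)
        · exact hs.sum_le_tsum _ fun q _ => by positivity
    _ = _ := by ring

/-! ### Pointwise lower bounds near fractions -/

/-- All summands have argument in [0, π/3], hence real part at least 1/2. -/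
theorem half_le_norm_weylSum_zero {N : ℕ} (hN : 1 ≤ N) {γ : ℝ} (h0 : 0 ≤ γ)
    (h1 : γ ≤ 1 / (6 * N)) : (N : ℝ) / 2 ≤ ‖weylSum N γ 0‖ := by
  have hN' : (0 : ℝ) < N := by exact_mod_cast hN
  refine le_trans ?_ ((le_abs_self _).trans (Complex.abs_re_le_norm _))
  rw [weylSum_eq, Complex.re_sum]
  have h : ∀ n ∈ Finset.Icc 1 N, (1 / 2 : ℝ) ≤ (ex (γ * n + 0 * n ^ 2)).re := by
    intro n hn
    have hn' : (n : ℝ) ≤ N := by exact_mod_cast (Finset.mem_Icc.1 hn).2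
    have hre : (ex (γ * n + 0 * n ^ 2)).re = Real.cos (2 * (Real.pi * (γ * n))) := by
      rw [ex_eq]
      simp [-Complex.ofReal_cos, -Complex.ofReal_sin]
    rw [hre, ← Real.cos_pi_div_three]
    have hγn : γ * n ≤ 1 / 6 := by
      calc γ * n ≤ 1 / (6 * N) * N := by gcongr
        _ = 1 / 6 := by field_simp
    have hp := Real.pi_pos
    have hγ0 : 0 ≤ γ * n := by positivity
    apply Real.cos_le_cos_of_nonneg_of_le_pi <;> nlinarith
  refine le_trans ?_ (Finset.sum_le_sum h)
  simp
  linarith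

theorem le_weylMoment_trivial {p : ℝ} (hp : 0 ≤ p) {N : ℕ} (hN : 1 ≤ N) :
    ((N : ℝ) / 2) ^ p / (6 * N) ≤ weylMoment p N := by
  have hN' : (1 : ℝ) ≤ N := by exact_mod_cast hN
  have hle : 1 / (6 * (N : ℝ)) ≤ 1 := by rw [div_le_one (by positivity)]; linarith
  have h1 : ∫ _ in (0 : ℝ)..(1 / (6 * N)), ((N : ℝ) / 2) ^ p ≤
      ∫ x in (0 : ℝ)..(1 / (6 * N)), weylMax p N x := by
    refine intervalIntegral.integral_mono_on (by positivity) (by simp)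
      ((continuous_weylMax hp N).intervalIntegrable _ _) fun x hx => ?_
    refine le_trans ?_ (le_weylMax hp N x le_rfl zero_le_one)
    gcongr
    exact half_le_norm_weylSum_zero hN hx.1 hx.2
  have h2 : ∫ x in (0 : ℝ)..(1 / (6 * N)), weylMax p N x ≤ weylMoment p N :=
    intervalIntegral.integral_mono_interval le_rfl (by positivity) hle
      (Filter.Eventually.of_forall fun x => weylMax_nonneg hp N x)
      (intervalIntegrable_weylMax hp N)
  rw [intervalIntegral.integral_const, smul_eq_mul] at h1
  refine le_trans (le_of_eq ?_) (h1.trans h2)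
  ring

/-- Near a fraction with small odd denominator the maximal function is large. -/
theorem le_weylMax_of_near_fraction {p : ℝ} (hp : 0 ≤ p) {N q : ℕ} (hq : Odd q) (hqN : q ^ 2 ≤ N)
    (hN : 480 ≤ (N : ℝ) ^ (3 / 8 : ℝ)) (b : ℕ) {x : ℝ} (h0 : (b : ℝ) / q ≤ x)
    (h1 : x ≤ b / q + 1 / (6 * N)) : ((N : ℝ) / (4 * √q)) ^ p ≤ weylMax p N x := by
  have hq1 : 1 ≤ q := hq.pos
  have hqR : (1 : ℝ) ≤ q := by exact_mod_cast hq1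
  have hN1 : 1 ≤ N := le_trans (by nlinarith) hqN
  have hNR : (1 : ℝ) ≤ N := by exact_mod_cast hN1
  have hqNR : (q : ℝ) ≤ N := by exact_mod_cast (by nlinarith : q ≤ N)
  have hqN2 : (q : ℝ) ^ 2 ≤ N := by exact_mod_cast hqN
  have : NeZero q := ⟨by omega⟩
  set γ := x - b / q with hγ
  have hγ0 : 0 ≤ γ := by linarith
  have hγ1 : γ ≤ 1 / (6 * N) := by linarith
  have hγ2 : |γ| ≤ 1 / (2 * q) := by
    rw [abs_of_nonneg hγ0]
    exact hγ1.trans (one_div_le_one_div_of_le (by positivity) (by linarith))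
  have ha : IsUnit ((1 : ℤ) : ZMod q) := by simp
  -- The witness is t = 1/q, that is a = 1 and β = 0; for odd q the Gauss sum has modulus exactly
  -- √q, whatever b is.
  have key := norm_weylSum_sub_le ha b hN1 hγ2 (β := 0) (by simp; positivity)
  rw [show ((b : ℤ) : ℝ) / q + γ = x by rw [hγ]; push_cast; ring] at key
  have hG : ‖quadGauss q ((1 : ℤ) : ZMod q) ((b : ℤ) : ZMod q) / q‖ = 1 / √q := by
    have h := norm_quadGauss_sq_of_odd q hq ha ((b : ℤ) : ZMod q)
    have h2 : ‖quadGauss q ((1 : ℤ) : ZMod q) ((b : ℤ) : ZMod q)‖ = √q := by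
      rw [← h, Real.sqrt_sq (norm_nonneg _)]
    rw [norm_div, Complex.norm_natCast, h2]
    exact Real.sqrt_div_self'
  have hT := half_le_norm_weylSum_zero hN1 hγ0 hγ1
  have hsq : √(q : ℝ) ≤ (N : ℝ) ^ (1 / 4 : ℝ) := by
    calc √(q : ℝ) = ((q : ℝ) ^ 2) ^ (1 / 4 : ℝ) := by
          rw [Real.sqrt_eq_rpow, ← Real.rpow_natCast, ← Real.rpow_mul (by positivity)]; norm_num
      _ ≤ _ := by gcongr
  have hq34 : (q : ℝ) ^ (3 / 4 : ℝ) ≤ (N : ℝ) ^ (3 / 8 : ℝ) := by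
    calc (q : ℝ) ^ (3 / 4 : ℝ) = ((q : ℝ) ^ 2) ^ (3 / 8 : ℝ) := by
          rw [← Real.rpow_natCast, ← Real.rpow_mul (by positivity)]; norm_num
      _ ≤ _ := by gcongr
  have hsq0 : 0 < √(q : ℝ) := by positivity
  -- The main term is at least N/(2√q), and the error takes at most half of it; 480 = 120 · 4 is the
  -- size required of N^{3/8}.
  have herr : 120 * (q : ℝ) ^ (3 / 4 : ℝ) ≤ N / (4 * √q) := by
    rw [le_div_iff₀ (by positivity)]
    calc 120 * (q : ℝ) ^ (3 / 4 : ℝ) * (4 * √q) ≤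
          120 * (N : ℝ) ^ (3 / 8 : ℝ) * (4 * (N : ℝ) ^ (1 / 4 : ℝ)) := by gcongr
      _ = 480 * ((N : ℝ) ^ (3 / 8 : ℝ) * (N : ℝ) ^ (1 / 4 : ℝ)) := by ring
      _ ≤ (N : ℝ) ^ (3 / 8 : ℝ) * ((N : ℝ) ^ (3 / 8 : ℝ) * (N : ℝ) ^ (1 / 4 : ℝ)) := by gcongr
      _ = N := by
          rw [← Real.rpow_add (by positivity), ← Real.rpow_add (by positivity)]; norm_num
  have ht : ((1 : ℤ) : ℝ) / q + 0 ≤ 1 := by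
    push_cast; rw [add_zero, div_le_one (by positivity)]; exact hqR
  refine le_trans ?_ (le_weylMax hp N x (by positivity) ht)
  refine Real.rpow_le_rpow (by positivity) ?_ hp
  have h3 := norm_sub_norm_le (quadGauss q ((1 : ℤ) : ZMod q) ((b : ℤ) : ZMod q) / q *
    weylSum N γ 0) (weylSum N x (((1 : ℤ) : ℝ) / q + 0))
  rw [norm_sub_rev] at h3
  rw [norm_mul, hG] at h3
  have h4 : 1 / √q * ((N : ℝ) / 2) ≤ 1 / √q * ‖weylSum N γ 0‖ := by gcongr
  have h5 : 1 / √q * ((N : ℝ) / 2) = N / (4 * √q) + N / (4 * √q) := by field_simp; norm_num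
  linarith

/-! ### Disjoint intervals and totient sums over odd numbers -/

/-- The odd numbers from `1` to `Q`. -/
def oddsUpTo (Q : ℕ) : Finset ℕ := (Finset.Icc 1 Q).filter Odd

theorem mem_oddsUpTo {Q q : ℕ} : q ∈ oddsUpTo Q ↔ (1 ≤ q ∧ q ≤ Q) ∧ Odd q := by
  simp [oddsUpTo]

theorem one_div_mul_le_abs_sub {q q' b b' : ℕ} (hq : 1 ≤ q) (hq' : 1 ≤ q')
    (hc : Nat.Coprime q b) (hc' : Nat.Coprime q' b') (hne : ¬ (q = q' ∧ b = b')) :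
    1 / ((q : ℝ) * q') ≤ |(b : ℝ) / q - b' / q'| := by
  have hqR : (0 : ℝ) < q := by exact_mod_cast hq
  have hqR' : (0 : ℝ) < q' := by exact_mod_cast hq'
  have hz : (b : ℤ) * q' - b' * q ≠ 0 := by
    intro h
    have h' : b * q' = b' * q := by zify; linarith
    apply hne
    have h1 : q ∣ q' := hc.dvd_of_dvd_mul_left ⟨b', by rw [h', mul_comm]⟩
    have h2 : q' ∣ q := hc'.dvd_of_dvd_mul_left ⟨b, by rw [← h', mul_comm]⟩
    have h3 := Nat.dvd_antisymm h1 h2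
    subst h3
    exact ⟨rfl, Nat.eq_of_mul_eq_mul_right hq h'⟩
  have h1 : (1 : ℝ) ≤ |(b : ℝ) * q' - b' * q| := by exact_mod_cast Int.one_le_abs hz
  have e : (b : ℝ) / q - b' / q' = (b * q' - b' * q) / (q * q') := by field_simp
  rw [e, abs_div, abs_of_pos (by positivity : (0 : ℝ) < q * q')]
  gcongr

/-- Distinct reduced fractions with denominators at most √N are at least 1/N apart, so intervals of
length 1/(6N) attached to them are disjoint. Each odd q contributes φ(q) of them. -/
theorem sum_totient_mul_le_weylMoment {p : ℝ} (hp : 0 ≤ p) {N : ℕ}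
    (hN : 480 ≤ (N : ℝ) ^ (3 / 8 : ℝ)) :
    ∑ q ∈ oddsUpTo N.sqrt, (q.totient : ℝ) * (((N : ℝ) / (4 * √q)) ^ p / (6 * N)) ≤
      weylMoment p N := by
  have hN1 : 1 ≤ N := by
    by_contra! h
    have : N = 0 := by omega
    rw [this] at hN
    norm_num at hN
  have hNR : (1 : ℝ) ≤ N := by exact_mod_cast hN1
  set P : Finset (Σ _ : ℕ, ℕ) := (oddsUpTo N.sqrt).sigma fun q => (Finset.range q).filter q.Coprime
    with hP
  set I : (Σ _ : ℕ, ℕ) → Set ℝ := fun z =>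
    Set.Ioc ((z.2 : ℝ) / z.1) ((z.2 : ℝ) / z.1 + 1 / (6 * N)) with hI
  have hmem : ∀ z ∈ P, 1 ≤ z.1 ∧ z.1 ^ 2 ≤ N ∧ Odd z.1 ∧ z.2 < z.1 ∧ z.1.Coprime z.2 := by
    intro z hz
    rw [hP, Finset.mem_sigma, mem_oddsUpTo, Finset.mem_filter, Finset.mem_range] at hz
    exact ⟨hz.1.1.1, Nat.le_sqrt'.1 hz.1.1.2, hz.1.2, hz.2.1, hz.2.2⟩
  have hinv : ∀ q : ℕ, 1 ≤ q → q ^ 2 ≤ N → 1 / (6 * (N : ℝ)) ≤ 1 / q := by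
    intro q h1 h2
    have h3 : (q : ℝ) ≤ N := by exact_mod_cast (by nlinarith : q ≤ N)
    have : (1 : ℝ) ≤ q := by exact_mod_cast h1
    exact one_div_le_one_div_of_le (by positivity) (by linarith)
  have hdisj : Set.Pairwise (P : Set (Σ _ : ℕ, ℕ)) (Function.onFun Disjoint I) := by
    intro z hz w hw hne
    obtain ⟨h1, h2, -, -, h5⟩ := hmem z hz
    obtain ⟨k1, k2, -, -, k5⟩ := hmem w hw
    rw [Function.onFun, Set.disjoint_left]
    intro x hx hx'
    have h := one_div_mul_le_abs_sub h1 k1 h5 k5 (fun h => hne (by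
      obtain ⟨z1, z2⟩ := z
      obtain ⟨w1, w2⟩ := w
      simp only at h
      rw [h.1, h.2]))
    have h1R : (1 : ℝ) ≤ z.1 := by exact_mod_cast h1
    have k1R : (1 : ℝ) ≤ w.1 := by exact_mod_cast k1
    have hprod : (z.1 : ℝ) * w.1 ≤ N := by
      have h2R : (z.1 : ℝ) ^ 2 ≤ N := by exact_mod_cast h2
      have k2R : (w.1 : ℝ) ^ 2 ≤ N := by exact_mod_cast k2
      nlinarith [sq_nonneg ((z.1 : ℝ) - w.1)]
    have h3 : 1 / (N : ℝ) ≤ 1 / ((z.1 : ℝ) * w.1) :=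
      one_div_le_one_div_of_le (by positivity) hprod
    have h4 : 1 / (6 * (N : ℝ)) < 1 / N := one_div_lt_one_div_of_lt (by positivity) (by linarith)
    have h5 : |(z.2 : ℝ) / z.1 - w.2 / w.1| ≤ 1 / (6 * N) := by
      rw [abs_le]
      constructor <;> linarith [hx.1, hx.2, hx'.1, hx'.2]
    linarith
  have hsub : (⋃ z ∈ P, I z) ⊆ Set.Ioc (0 : ℝ) 1 := by
    refine Set.iUnion₂_subset fun z hz x hx => ?_
    obtain ⟨h1, h2, -, h4, -⟩ := hmem z hz
    have h1R : (0 : ℝ) < z.1 := by exact_mod_cast h1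
    have h4R : (z.2 : ℝ) + 1 ≤ z.1 := by exact_mod_cast h4
    have h5 : (0 : ℝ) ≤ (z.2 : ℝ) / z.1 := by positivity
    have h6 : (z.2 : ℝ) / z.1 + 1 / z.1 ≤ 1 := by
      rw [← add_div, div_le_one h1R]; exact h4R
    have h7 := hinv _ h1 h2
    exact ⟨by linarith [hx.1], by linarith [hx.2]⟩
  have hcont := continuous_weylMax hp N
  have hint : MeasureTheory.IntegrableOn (weylMax p N) (Set.Ioc 0 1) :=
    (intervalIntegrable_iff_integrableOn_Ioc_of_le zero_le_one).1 (intervalIntegrable_weylMax hp N)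
  have h1 : ∑ z ∈ P, ∫ x in I z, weylMax p N x ≤ weylMoment p N := by
    rw [← MeasureTheory.integral_biUnion_finset P (fun z _ => measurableSet_Ioc) hdisj
      (fun z hz => hint.mono_set ((Set.subset_biUnion_of_mem (u := I) hz).trans hsub)),
      weylMoment, intervalIntegral.integral_of_le zero_le_one]
    exact MeasureTheory.setIntegral_mono_set hint
      (Filter.Eventually.of_forall fun x => weylMax_nonneg hp N x) hsub.eventuallyLE
  refine le_trans ?_ h1
  have h2 : ∀ z ∈ P, ((N : ℝ) / (4 * √(z.1 : ℝ))) ^ p / (6 * N) ≤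
      ∫ x in I z, weylMax p N x := by
    intro z hz
    obtain ⟨h1, h2, h3, h4, -⟩ := hmem z hz
    have hle : (z.2 : ℝ) / z.1 ≤ (z.2 : ℝ) / z.1 + 1 / (6 * N) := by
      have : 0 ≤ 1 / (6 * (N : ℝ)) := by positivity
      linarith
    rw [hI, ← intervalIntegral.integral_of_le hle]
    have h5 := intervalIntegral.integral_mono_on (μ := MeasureTheory.volume) hle
      (f := fun _ => ((N : ℝ) / (4 * √(z.1 : ℝ))) ^ p) (by simp)
      (hcont.intervalIntegrable _ _)
      fun x hx => le_weylMax_of_near_fraction hp h3 h2 hN z.2 hx.1 hx.2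
    rw [intervalIntegral.integral_const, smul_eq_mul] at h5
    refine le_trans (le_of_eq ?_) h5
    ring
  refine le_trans (le_of_eq ?_) (Finset.sum_le_sum h2)
  rw [hP, Finset.sum_sigma]
  refine Finset.sum_congr rfl fun q _ => ?_
  simp only [Finset.sum_const, nsmul_eq_mul, Nat.totient]

/-- Insert q = ∑ φ(d) over d ∣ q and exchange the sums; divisors of odd numbers are odd. -/
theorem sum_odds_mul_eq (Q : ℕ) (w : ℕ → ℝ) :
    ∑ q ∈ oddsUpTo Q, (q : ℝ) * w q =
      ∑ d ∈ oddsUpTo Q, (d.totient : ℝ) * ∑ q ∈ (oddsUpTo Q).filter (d ∣ ·), w q := by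
  have h : ∀ q ∈ oddsUpTo Q, (q : ℝ) * w q =
      ∑ d ∈ oddsUpTo Q, if d ∣ q then (d.totient : ℝ) * w q else 0 := by
    intro q hq
    have hq' := mem_oddsUpTo.1 hq
    rw [← Finset.sum_filter, ← Finset.sum_mul]
    congr 1
    have e : (oddsUpTo Q).filter (· ∣ q) = q.divisors := by
      ext d
      rw [Finset.mem_filter, mem_oddsUpTo, Nat.mem_divisors]
      refine ⟨fun h => ⟨h.2, by omega⟩, fun h => ⟨⟨⟨?_, ?_⟩, ?_⟩, h.1⟩⟩
      · exact Nat.pos_of_dvd_of_pos h.1 (by omega)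
      · exact (Nat.le_of_dvd (by omega) h.1).trans hq'.1.2
      · exact hq'.2.of_dvd_nat h.1
    rw [e]
    exact_mod_cast (Nat.sum_totient q).symm
  rw [Finset.sum_congr rfl h, Finset.sum_comm]
  refine Finset.sum_congr rfl fun d _ => ?_
  rw [Finset.mul_sum, Finset.sum_filter]

theorem sum_range_le_sum_odds (Q : ℕ) (f : ℕ → ℝ) (hf : ∀ n, 0 ≤ f n) :
    ∑ j ∈ Finset.range ((Q + 1) / 2), f (2 * j + 1) ≤ ∑ q ∈ oddsUpTo Q, f q := by
  rw [← Finset.sum_image (s := Finset.range ((Q + 1) / 2)) (g := fun j => 2 * j + 1) (f := f)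
    (fun a _ b _ h => by simp only at h; omega)]
  refine Finset.sum_le_sum_of_subset_of_nonneg ?_ fun n _ _ => hf n
  intro q hq
  obtain ⟨j, hj, rfl⟩ := Finset.mem_image.1 hq
  have := Finset.mem_range.1 hj
  exact mem_oddsUpTo.2 ⟨⟨by omega, by omega⟩, ⟨j, rfl⟩⟩

theorem sq_div_four_le_sum_odds (Q : ℕ) : (Q : ℝ) ^ 2 / 4 ≤ ∑ q ∈ oddsUpTo Q, (q : ℝ) := by
  refine le_trans ?_ (sum_range_le_sum_odds Q (fun n => (n : ℝ)) fun n => Nat.cast_nonneg n)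
  have h : ∀ M : ℕ, ∑ j ∈ Finset.range M, ((2 * j + 1 : ℕ) : ℝ) = (M : ℝ) ^ 2 := by
    intro M
    induction M with
    | zero => simp
    | succ n ih => rw [Finset.sum_range_succ, ih]; push_cast; ring
  rw [h]
  have h2 : (Q : ℝ) ≤ 2 * ((Q + 1) / 2 : ℕ) := by exact_mod_cast (by omega : Q ≤ 2 * ((Q + 1) / 2))
  have h3 : (0 : ℝ) ≤ Q := Nat.cast_nonneg Q
  nlinarith

theorem sq_div_le_sum_totient_odds (Q : ℕ) :
    (Q : ℝ) ^ 2 / 64 ≤ ∑ d ∈ oddsUpTo Q, (d.totient : ℝ) := by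
  rcases Nat.eq_zero_or_pos Q with rfl | hQ
  · simp [oddsUpTo]
  have hQR : (0 : ℝ) < Q := by exact_mod_cast hQ
  have h1 : (Q : ℝ) ^ 2 / 4 ≤ ∑ d ∈ oddsUpTo Q, (d.totient : ℝ) * (Q / d) := by
    refine (sq_div_four_le_sum_odds Q).trans ?_
    have h := sum_odds_mul_eq Q fun _ => 1
    simp only [mul_one] at h
    rw [h]
    refine Finset.sum_le_sum fun d hd => ?_
    gcongr
    rw [Finset.sum_const, nsmul_eq_mul, mul_one]
    have e : ((oddsUpTo Q).filter (d ∣ ·)).card ≤ Q / d := by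
      rw [← Nat.Ioc_filter_dvd_card_eq_div]
      refine Finset.card_le_card fun q hq => ?_
      rw [Finset.mem_filter, mem_oddsUpTo] at hq
      rw [Finset.mem_filter, Finset.mem_Ioc]
      exact ⟨⟨by omega, hq.1.1.2⟩, hq.2⟩
    calc _ ≤ ((Q / d : ℕ) : ℝ) := by exact_mod_cast e
      _ ≤ _ := Nat.cast_div_le
  -- For d > Q/8 the weight Q/d is below 8. Smaller d contribute at most Q each, in total Q²/8,
  -- which is half of the available Q²/4.
  have h2 : ∀ d ∈ oddsUpTo Q, (d.totient : ℝ) * (Q / d) ≤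
      8 * (d.totient : ℝ) + (if 8 * d ≤ Q then (Q : ℝ) else 0) := by
    intro d hd
    have hd1 : (1 : ℝ) ≤ d := by exact_mod_cast (mem_oddsUpTo.1 hd).1.1
    have ht : (d.totient : ℝ) ≤ d := by exact_mod_cast Nat.totient_le d
    have ht0 : (0 : ℝ) ≤ d.totient := Nat.cast_nonneg _
    split_ifs with h
    · have : (d.totient : ℝ) * (Q / d) ≤ d * (Q / d) := by gcongr
      have e : (d : ℝ) * (Q / d) = Q := by field_simp
      linarith
    · have h' : (Q : ℝ) ≤ 8 * d := by exact_mod_cast (not_le.1 h).le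
      have : (Q : ℝ) / d ≤ 8 := by rw [div_le_iff₀ (by positivity)]; exact h'
      nlinarith
  have h3 : ∑ d ∈ oddsUpTo Q, (if 8 * d ≤ Q then (Q : ℝ) else 0) ≤ (Q : ℝ) ^ 2 / 8 := by
    rw [← Finset.sum_filter, Finset.sum_const, nsmul_eq_mul]
    have e : ((oddsUpTo Q).filter (8 * · ≤ Q)).card ≤ Q / 8 := by
      calc _ ≤ (Finset.Icc 1 (Q / 8)).card := Finset.card_le_card fun d hd => by
            rw [Finset.mem_filter, mem_oddsUpTo] at hd
            rw [Finset.mem_Icc]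
            omega
        _ = _ := by simp
    have e2 : (((oddsUpTo Q).filter (8 * · ≤ Q)).card : ℝ) ≤ Q / 8 := by
      calc _ ≤ ((Q / 8 : ℕ) : ℝ) := by exact_mod_cast e
        _ ≤ _ := by simpa using Nat.cast_div_le (α := ℝ) (m := Q) (n := 8)
    nlinarith
  have h4 := h1.trans (Finset.sum_le_sum h2)
  rw [Finset.sum_add_distrib, ← Finset.mul_sum] at h4
  linarith

/-- The weight 1/q² in the divisor identity: the sum over multiples q = dm is at most ζ(2)/d². This
transfers the logarithmic divergence of ∑ 1/q to ∑ φ(d)/d². -/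
theorem sum_one_div_odds_le (Q : ℕ) : ∑ q ∈ oddsUpTo Q, 1 / (q : ℝ) ≤
    (∑' m : ℕ, 1 / (m : ℝ) ^ 2) * ∑ d ∈ oddsUpTo Q, (d.totient : ℝ) / (d : ℝ) ^ 2 := by
  have hs : Summable fun m : ℕ => 1 / (m : ℝ) ^ 2 := Real.summable_one_div_nat_pow.2 one_lt_two
  have h := sum_odds_mul_eq Q fun q => 1 / (q : ℝ) ^ 2
  have e : ∑ q ∈ oddsUpTo Q, (q : ℝ) * (1 / (q : ℝ) ^ 2) = ∑ q ∈ oddsUpTo Q, 1 / (q : ℝ) := by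
    refine Finset.sum_congr rfl fun q hq => ?_
    have : (1 : ℝ) ≤ q := by exact_mod_cast (mem_oddsUpTo.1 hq).1.1
    field_simp
  rw [← e, h, Finset.mul_sum]
  refine Finset.sum_le_sum fun d hd => ?_
  have hd1 := (mem_oddsUpTo.1 hd).1.1
  have hdR : (1 : ℝ) ≤ d := by exact_mod_cast hd1
  have h2 : ∑ q ∈ (oddsUpTo Q).filter (d ∣ ·), 1 / (q : ℝ) ^ 2 ≤
      (∑' m : ℕ, 1 / (m : ℝ) ^ 2) / (d : ℝ) ^ 2 := by
    calc _ ≤ ∑ q ∈ (Finset.range (Q + 1)).image (d * ·), 1 / (q : ℝ) ^ 2 := by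
          refine Finset.sum_le_sum_of_subset_of_nonneg (fun q hq => ?_) fun q _ _ => by positivity
          rw [Finset.mem_filter, mem_oddsUpTo] at hq
          obtain ⟨m, rfl⟩ := hq.2
          refine Finset.mem_image.2 ⟨m, Finset.mem_range.2 ?_, rfl⟩
          nlinarith
      _ = ∑ m ∈ Finset.range (Q + 1), 1 / (m : ℝ) ^ 2 / (d : ℝ) ^ 2 := by
          rw [Finset.sum_image fun a _ b _ h => Nat.eq_of_mul_eq_mul_left hd1 h]
          refine Finset.sum_congr rfl fun m _ => ?_
          push_cast
          rw [mul_pow, div_div, mul_comm]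
      _ ≤ _ := by
          rw [← Finset.sum_div]
          gcongr
          exact hs.sum_le_tsum _ fun m _ => by positivity
  calc _ ≤ (d.totient : ℝ) * ((∑' m : ℕ, 1 / (m : ℝ) ^ 2) / (d : ℝ) ^ 2) := by gcongr
    _ = _ := by ring

theorem log_div_two_le_sum_one_div_odds (Q : ℕ) :
    Real.log ((Q + 1) / 2) / 2 ≤ ∑ q ∈ oddsUpTo Q, 1 / (q : ℝ) := by
  refine le_trans ?_ (sum_range_le_sum_odds Q (fun n => 1 / (n : ℝ)) fun n => by positivity)
  set M := (Q + 1) / 2 with hM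
  have h1 := log_add_one_le_harmonic M
  have h2 : Real.log (((Q : ℝ) + 1) / 2) ≤ Real.log ((M + 1 : ℕ) : ℝ) := by
    apply Real.log_le_log (by positivity)
    rw [div_le_iff₀ (by norm_num)]
    exact_mod_cast (by omega : Q + 1 ≤ (M + 1) * 2)
  have h3 : (harmonic M : ℝ) / 2 ≤ ∑ j ∈ Finset.range M, 1 / ((2 * j + 1 : ℕ) : ℝ) := by
    rw [harmonic]
    push_cast
    rw [Finset.sum_div]
    refine Finset.sum_le_sum fun j _ => ?_
    rw [inv_eq_one_div, div_div]
    exact one_div_le_one_div_of_le (by positivity) (by linarith)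
  linarith

/-! ### Lower bounds for the moments and conclusion -/

theorem exists_le_rpow_three_eighths :
    ∃ N₀ : ℕ, ∀ N : ℕ, N₀ ≤ N → 16 ≤ N ∧ 480 ≤ (N : ℝ) ^ (3 / 8 : ℝ) := by
  have h := (tendsto_rpow_atTop (y := 3 / 8) (by norm_num)).comp
    (tendsto_natCast_atTop_atTop (R := ℝ))
  obtain ⟨N₀, h₀⟩ := Filter.eventually_atTop.1
    ((Filter.eventually_ge_atTop 16).and (h.eventually_ge_atTop 480))
  exact ⟨N₀, h₀⟩

theorem le_sqrt_add_one_sq (N : ℕ) : (N : ℝ) ≤ ((N.sqrt : ℝ) + 1) ^ 2 := by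
  exact_mod_cast (Nat.lt_succ_sqrt' N).le

theorem exists_rpow_le_weylMoment {p : ℝ} (hp : 1 ≤ p) : ∃ c : ℝ, 0 < c ∧ ∃ N₀ : ℕ,
    ∀ N : ℕ, N₀ ≤ N → c * (N : ℝ) ^ (3 * p / 4) ≤ weylMoment p N := by
  obtain ⟨N₀, h₀⟩ := exists_le_rpow_three_eighths
  refine ⟨(1 / 4) ^ p / 1536, by positivity, N₀, fun N hN => ?_⟩
  obtain ⟨h16, h480⟩ := h₀ N hN
  have hNR : (16 : ℝ) ≤ N := by exact_mod_cast h16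
  refine le_trans ?_ (sum_totient_mul_le_weylMoment (p := p) (by linarith) h480)
  -- Since √q ≤ N^{1/4}, every interval has height at least (N^{3/4}/4)^p, and only the number of
  -- intervals, of order N, matters.
  have hterm : ∀ q ∈ oddsUpTo N.sqrt, (q.totient : ℝ) *
      ((1 / 4) ^ p * (N : ℝ) ^ (3 * p / 4) / (6 * N)) ≤
      (q.totient : ℝ) * (((N : ℝ) / (4 * √q)) ^ p / (6 * N)) := by
    intro q hq
    have hq' := mem_oddsUpTo.1 hq
    have hq1 : (1 : ℝ) ≤ q := by exact_mod_cast hq'.1.1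
    have hq2 : (q : ℝ) ≤ (N : ℝ) ^ (1 / 2 : ℝ) :=
      le_trans (by exact_mod_cast hq'.1.2) (sqrt_cast_le_rpow N)
    have hs : √(q : ℝ) ≤ (N : ℝ) ^ (1 / 4 : ℝ) := by
      rw [Real.sqrt_eq_rpow]
      calc _ ≤ ((N : ℝ) ^ (1 / 2 : ℝ)) ^ (1 / 2 : ℝ) := by gcongr
        _ = _ := by rw [← Real.rpow_mul (by positivity)]; norm_num
    gcongr
    have e : (1 / 4) ^ p * (N : ℝ) ^ (3 * p / 4) = (1 / 4 * (N : ℝ) ^ (3 / 4 : ℝ)) ^ p := by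
      rw [Real.mul_rpow (by norm_num) (by positivity), ← Real.rpow_mul (by positivity)]
      ring_nf
    rw [e]
    have hs0 : 0 < √(q : ℝ) := by positivity
    refine Real.rpow_le_rpow (by positivity) ?_ (by linarith)
    rw [le_div_iff₀ (by positivity)]
    calc 1 / 4 * (N : ℝ) ^ (3 / 4 : ℝ) * (4 * √q) ≤
          1 / 4 * (N : ℝ) ^ (3 / 4 : ℝ) * (4 * (N : ℝ) ^ (1 / 4 : ℝ)) := by gcongr
      _ = (N : ℝ) ^ (3 / 4 : ℝ) * (N : ℝ) ^ (1 / 4 : ℝ) := by ring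
      _ = N := by rw [← Real.rpow_add (by positivity)]; norm_num
  refine le_trans ?_ (Finset.sum_le_sum hterm)
  rw [← Finset.sum_mul]
  have h1 := sq_div_le_sum_totient_odds N.sqrt
  have h2 := le_sqrt_add_one_sq N
  have h3 : (1 : ℝ) ≤ N.sqrt := by exact_mod_cast Nat.le_sqrt'.2 (by omega)
  have h4 : (N : ℝ) / 256 ≤ ∑ d ∈ oddsUpTo N.sqrt, (d.totient : ℝ) := by nlinarith
  calc (1 / 4) ^ p / 1536 * (N : ℝ) ^ (3 * p / 4) =
        N / 256 * ((1 / 4) ^ p * (N : ℝ) ^ (3 * p / 4) / (6 * N)) := by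
        field_simp; norm_num
    _ ≤ _ := by gcongr

theorem exists_le_weylMoment_of_eq_four : ∃ c : ℝ, 0 < c ∧ ∃ N₀ : ℕ,
    ∀ N : ℕ, N₀ ≤ N → c * ((N : ℝ) ^ (3 : ℝ) * Real.log N) ≤ weylMoment 4 N := by
  obtain ⟨N₀, h₀⟩ := exists_le_rpow_three_eighths
  set Z : ℝ := ∑' m : ℕ, 1 / (m : ℝ) ^ 2 with hZ
  have hs : Summable fun m : ℕ => 1 / (m : ℝ) ^ 2 := Real.summable_one_div_nat_pow.2 one_lt_two
  have hZ0 : 0 < Z := hs.tsum_pos (fun m => by positivity) 1 (by norm_num)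
  refine ⟨1 / (12288 * Z), by positivity, N₀, fun N hN => ?_⟩
  obtain ⟨h16, h480⟩ := h₀ N hN
  have hNR : (16 : ℝ) ≤ N := by exact_mod_cast h16
  refine le_trans ?_ (sum_totient_mul_le_weylMoment (p := 4) (by norm_num) h480)
  -- At p = 4 the weight is φ(q)/q², so all scales of q contribute equally and produce the
  -- logarithm; 1536 = 4⁴ · 6.
  have hterm : ∀ q ∈ oddsUpTo N.sqrt, (q.totient : ℝ) * (((N : ℝ) / (4 * √q)) ^ (4 : ℝ) / (6 * N)) =
      (N : ℝ) ^ 3 / 1536 * ((q.totient : ℝ) / (q : ℝ) ^ 2) := by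
    intro q hq
    have hq1 : (1 : ℝ) ≤ q := by exact_mod_cast (mem_oddsUpTo.1 hq).1.1
    have e : √(q : ℝ) ^ 4 = (q : ℝ) ^ 2 := by
      rw [show √(q : ℝ) ^ 4 = (√(q : ℝ) ^ 2) ^ 2 by ring, Real.sq_sqrt (by positivity)]
    rw [show (4 : ℝ) = ((4 : ℕ) : ℝ) by norm_num, Real.rpow_natCast, div_pow, mul_pow, e]
    push_cast
    field_simp
    ring
  rw [Finset.sum_congr rfl hterm, ← Finset.mul_sum]
  have h1 := sum_one_div_odds_le N.sqrt
  have h2 := log_div_two_le_sum_one_div_odds N.sqrt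
  have h3 : Real.log N / 8 ≤ Real.log (((N.sqrt : ℝ) + 1) / 2) / 2 := by
    have h4 : (N : ℝ) ≤ (((N.sqrt : ℝ) + 1) / 2) ^ 4 := by
      have h5 := le_sqrt_add_one_sq N
      have h6 : (16 : ℝ) ≤ ((N.sqrt : ℝ) + 1) ^ 2 := hNR.trans h5
      have h7 : (((N.sqrt : ℝ) + 1) / 2) ^ 4 =
          ((N.sqrt : ℝ) + 1) ^ 2 * ((N.sqrt : ℝ) + 1) ^ 2 / 16 := by ring
      rw [h7]
      nlinarith
    have h8 := Real.log_le_log (by linarith) h4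
    rw [Real.log_pow] at h8
    push_cast at h8
    linarith
  have h9 : Real.log N / (8 * Z) ≤
      ∑ d ∈ oddsUpTo N.sqrt, (d.totient : ℝ) / (d : ℝ) ^ 2 := by
    rw [div_le_iff₀ (by positivity)]
    linarith
  have h10 : (N : ℝ) ^ (3 : ℝ) = (N : ℝ) ^ 3 := by
    rw [show (3 : ℝ) = ((3 : ℕ) : ℝ) by norm_num, Real.rpow_natCast]
  calc 1 / (12288 * Z) * ((N : ℝ) ^ (3 : ℝ) * Real.log N) =
        (N : ℝ) ^ 3 / 1536 * (Real.log N / (8 * Z)) := by rw [h10]; field_simp; ring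
    _ ≤ _ := by gcongr

/-- A lower bound for large `N` extends to all `N ≥ 2`. -/
theorem exists_le_weylMoment_of_eventually {p a b : ℝ} (hp : 0 ≤ p) (ha : 0 ≤ a) (hb : 0 ≤ b)
    (h : ∃ c : ℝ, 0 < c ∧ ∃ N₀ : ℕ, ∀ N : ℕ, N₀ ≤ N →
      c * ((N : ℝ) ^ a * Real.log N ^ b) ≤ weylMoment p N) :
    ∃ c : ℝ, 0 < c ∧ ∀ N : ℕ, 2 ≤ N → c * ((N : ℝ) ^ a * Real.log N ^ b) ≤ weylMoment p N := by
  obtain ⟨c, hc, N₀, h⟩ := h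
  set M : ℕ := max N₀ 2 with hM
  have hM2 : (2 : ℝ) ≤ M := by exact_mod_cast le_max_right N₀ 2
  have hlM : 0 < Real.log M := Real.log_pos (by linarith)
  set F : ℝ := (M : ℝ) ^ a * Real.log M ^ b with hF
  have hF0 : 0 < F := by positivity
  -- For 2 ≤ N < N₀ the trivial bound gives at least 1/(6M), because N/2 ≥ 1, while the growth
  -- function is at most its value F at M.
  refine ⟨min c (1 / (6 * M) / F), by positivity, fun N hN => ?_⟩
  have hN2 : (2 : ℝ) ≤ N := by exact_mod_cast hN
  have hlN : 0 < Real.log N := Real.log_pos (by linarith)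
  rcases le_or_gt N₀ N with hle | hlt
  · refine le_trans ?_ (h N hle)
    gcongr
    exact min_le_left _ _
  · have hNM : (N : ℝ) ≤ M := by exact_mod_cast hlt.le.trans (le_max_left _ _)
    calc min c (1 / (6 * M) / F) * ((N : ℝ) ^ a * Real.log N ^ b) ≤ 1 / (6 * M) / F * F := by
          gcongr ?_ * ?_
          · exact min_le_right _ _
          · rw [hF]
            gcongr
      _ = 1 / (6 * M) := by field_simp
      _ ≤ ((N : ℝ) / 2) ^ p / (6 * N) := by
          have h1 : 1 ≤ ((N : ℝ) / 2) ^ p := Real.one_le_rpow (by linarith) hp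
          gcongr
      _ ≤ _ := le_weylMoment_trivial hp (by omega)

theorem mainTheorem1 (p : ℝ) (hp : 1 ≤ p) :
    ∃ c C : ℝ, 0 < c ∧ 0 < C ∧ ∀ N : ℕ, 2 ≤ N →
      c * ((N : ℝ) ^ weylExpA p * Real.log N ^ weylExpB p) ≤ weylMoment p N ∧
      weylMoment p N ≤ C * ((N : ℝ) ^ weylExpA p * Real.log N ^ weylExpB p) := by
  have hA : 0 ≤ weylExpA p := by unfold weylExpA; split_ifs <;> linarith
  have hB : 0 ≤ weylExpB p := by unfold weylExpB; split_ifs <;> norm_num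
  suffices H : (∃ c : ℝ, 0 < c ∧ ∃ N₀ : ℕ, ∀ N : ℕ, N₀ ≤ N →
      c * ((N : ℝ) ^ weylExpA p * Real.log N ^ weylExpB p) ≤ weylMoment p N) ∧
      ∃ C : ℝ, 0 < C ∧ ∀ N : ℕ, 2 ≤ N →
        weylMoment p N ≤ C * ((N : ℝ) ^ weylExpA p * Real.log N ^ weylExpB p) by
    obtain ⟨c, hc, hlow⟩ := exists_le_weylMoment_of_eventually (by linarith) hA hB H.1
    obtain ⟨C, hC, hup⟩ := H.2
    exact ⟨c, C, hc, hC, fun N hN => ⟨hlow N hN, hup N hN⟩⟩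
  rcases lt_trichotomy p 4 with h | rfl | h
  · have e1 : weylExpA p = 3 * p / 4 := if_pos h.le
    have e2 : weylExpB p = 0 := if_neg h.ne
    simp only [e1, e2, Real.rpow_zero, mul_one]
    obtain ⟨C, hC, hup⟩ := exists_weylMoment_le_of_lt_four hp h
    exact ⟨exists_rpow_le_weylMoment hp, C, hC, fun N hN => hup N (by omega)⟩
  · have e1 : weylExpA 4 = 3 := by unfold weylExpA; norm_num
    have e2 : weylExpB 4 = 1 := if_pos rfl
    simp only [e1, e2, Real.rpow_one]
    exact ⟨exists_le_weylMoment_of_eq_four, exists_weylMoment_le_of_eq_four⟩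
  · have e1 : weylExpA p = p - 1 := if_neg h.not_ge
    have e2 : weylExpB p = 0 := if_neg h.ne'
    simp only [e1, e2, Real.rpow_zero, mul_one]
    obtain ⟨C, hC, hup⟩ := exists_weylMoment_le_of_four_lt h
    -- For p > 4 the interval at x = 0 with t = 0 alone has the full order N^{p-1}.
    refine ⟨⟨(1 / 2) ^ p / 6, by positivity, 1, fun N hN => ?_⟩, C, hC,
      fun N hN => hup N (by omega)⟩
    have hNR : (0 : ℝ) < N := by exact_mod_cast hN
    refine le_trans (le_of_eq ?_) (le_weylMoment_trivial (by linarith) hN)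
    rw [Real.rpow_sub_one hNR.ne', Real.div_rpow (by norm_num) (by norm_num), Real.one_rpow,
      Real.div_rpow hNR.le (by norm_num)]
    field_simp
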